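/- All graphs are simple and undirected, possibly infinite. A graph map sends every edge to an edge or to a vertex. Let $I^n$ be the graph with vertex set $\{0,1\}^n$ in which two vertices are adjacent if and only if they differ in exactly one coordinate. A singular $n$-cube of a graph $G$ is a graph map $\sigma\colon I^n\to G$; its image is the subgraph formed by the image vertices and the images of the edges that are edges. Its front and back $i$-faces $f_i^-\sigma$, $f_i^+\sigma$ are obtained by fixing the $i$-th coordinate to be $0$, respectively $1$, and $\sigma$ is degenerate if $f_i^-\sigma=f_i^+\sigma$ for some $i$. Let $C_n(G)$ be the free abelian group on the singular $n$-cubes modulo the span of the degenerate ones, with boundary $\partial\sigma=\sum_{i}(-1)^i(f_i^-\sigma-f_i^+\sigma)$. The discrete cubical homology of $G$ is $H_n(G)=H_n(C_*(G))$. Let $CW^\Box(G)$ be the CW complex obtained by filling in with a solid $n$-cube every subgraph of $G$ isomorphic to $I^n$, for every $n\ge 0$. Its characteristic maps are given by the injective singular cubes. Its cellular chain group $C^{\mathrm{cell}}_n(CW^\Box(G))$ is the free abelian group on the injective singular $n$-cubes modulo the relations $\sigma\circ T=\pm\sigma$, where $T$ runs through the symmetries of $\{0,1\}^n$ (coordinate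 permutations combined with reflections of coordinates) and the sign is $+$ if $T$ preserves the orientation of the cube and $-$ if it reverses it. Thus it is free abelian with one generator, well defined up to sign, for each subgraph isomorphic to $I^n$. Its boundary is given by the same formula as above, and $H_n(CW^\Box(G))$ is the homology of this complex. The graph $G$ is called $n$-quasimonophobic if every subgraph $Q$ of $G$ isomorphic to $I^n$ is an induced subgraph of $G$, and whenever a noninjective singular $(n+1)$-cube of $G$ has an $n$-dimensional face with image equal to $Q$, it has at least one further $n$-dimensional face with image equal to $Q$. Theorem. If $G$ is both $1$-quasimonophobic and $2$-quasimonophobic, then $$H_2(G)\cong H_2\bigl(CW^\Box(G)\bigr).$$ More precisely, discarding the noninjective singular $2$-cubes from a cycle in $C_2(G)$, and reading each injective singular $2$-cube as the oriented $2$-cell that it parametrizes, gives a cycle in $C^{\mathrm{cell}}_2(CW^\Box(G))$, and this assignment induces an isomorphism $H_2(G)\to H_2(CW^\Box(G))$. -/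

import Mathlib

open CategoryTheory

universe u

noncomputable section

namespace DiscreteCubical

/-! ### Graph maps, discrete cubes, singular cubes -/

/-- A graph map sends every edge to an edge or to a vertex. -/
@[ext]
structure GraphMap {V W : Type*} (G : SimpleGraph V) (H : SimpleGraph W) where
  toFun : V → W
  map_adj : ∀ {x y : V}, G.Adj x y → toFun x = toFun y ∨ H.Adj (toFun x) (toFun y)

/-- The discrete `n`-cube: vertex set `{0,1}ⁿ` (`false` is `0`, `true` is `1`), two vertices being
adjacent iff they differ in exactly one coordinate. -/
def cubeGraph (n : ℕ) : SimpleGraph (Fin n → Bool) where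
  Adj x y := ∃! i, x i ≠ y i
  symm := ⟨fun _ _ h => by simpa only [ne_comm] using h⟩
  loopless := ⟨fun _ h => by
    obtain ⟨i, hi, -⟩ := h
    exact hi rfl⟩

/-- Singular `n`-cubes of `G`. -/
abbrev SingularCube {V : Type u} (G : SimpleGraph V) (n : ℕ) : Type u :=
  GraphMap (cubeGraph n) G

section

variable {V : Type u} {G : SimpleGraph V} {n : ℕ}

theorem cubeGraph_adj_insertNth (i : Fin (n + 1)) (a : Bool) {x y : Fin n → Bool}
    (h : (cubeGraph n).Adj x y) :
    (cubeGraph (n + 1)).Adj (i.insertNth a x : Fin (n + 1) → Bool) (i.insertNth a y) := by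
  obtain ⟨k, hk, hu⟩ := h
  refine ⟨i.succAbove k, by simpa using hk, fun j hj => ?_⟩
  rcases Fin.eq_self_or_eq_succAbove i j with rfl | ⟨l, rfl⟩
  · simp at hj
  · rw [hu l (by simpa using hj)]

/-- The face of a singular cube obtained by fixing the `i`-th coordinate equal to `a`:
the front face for `a = false` and the back face for `a = true`. -/
def SingularCube.face (i : Fin (n + 1)) (a : Bool) (σ : SingularCube G (n + 1)) :
    SingularCube G n where
  toFun t := σ.toFun (i.insertNth a t)
  map_adj h := σ.map_adj (cubeGraph_adj_insertNth i a h)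

theorem insertNth_insertNth (j : Fin (n + 2)) (i : Fin (n + 1)) (a b : Bool) (t : Fin n → Bool) :
    (j.insertNth b (i.insertNth a t : Fin (n + 1) → Bool) : Fin (n + 2) → Bool) =
      (j.succAbove i).insertNth a ((i.predAbove j).insertNth b t : Fin (n + 1) → Bool) := by
  rw [Fin.insertNth_eq_iff]
  refine ⟨?_, ?_⟩
  · have := Fin.insertNth_apply_succAbove (α := fun _ => Bool) (j.succAbove i) a
      ((i.predAbove j).insertNth b t : Fin (n + 1) → Bool) (i.predAbove j)
    rw [Fin.succAbove_succAbove_predAbove] at this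
    rw [this, Fin.insertNth_apply_same]
  · rw [Fin.insertNth_eq_iff]
    refine ⟨by simp [Fin.removeNth], ?_⟩
    funext k
    simp only [Fin.removeNth]
    rw [← Fin.succAbove_succAbove_succAbove_predAbove j i k]
    simp

theorem SingularCube.face_face (σ : SingularCube G (n + 2)) (j : Fin (n + 2)) (i : Fin (n + 1))
    (a b : Bool) :
    face i a (face j b σ) = face (i.predAbove j) b (face (j.succAbove i) a σ) := by
  ext t
  simp only [face, insertNth_insertNth j i a b t]

/-- A singular cube is degenerate if for some `i` its front and back `i`-faces agree. -/
def SingularCube.IsDegenerate (σ : SingularCube G n) : Prop :=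
  ∃ i : Fin n, ∀ t, σ.toFun (Function.update t i false) = σ.toFun (Function.update t i true)

theorem SingularCube.isDegenerate_iff (σ : SingularCube G (n + 1)) :
    σ.IsDegenerate ↔ ∃ i, face i false σ = face i true σ := by
  refine exists_congr fun i => ⟨fun h => ?_, fun h t => ?_⟩
  · ext t
    simpa [face] using h (i.insertNth false t)
  · have := congrArg (fun τ => τ.toFun (i.removeNth t)) h
    simpa [face] using this

/-- The image of a singular cube: the image vertices, and the edges of `G` that are images of
edges of the discrete cube. -/
def SingularCube.image (σ : SingularCube G n) : G.Subgraph where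
  verts := Set.range σ.toFun
  Adj x y := G.Adj x y ∧ ∃ s t, (cubeGraph n).Adj s t ∧ σ.toFun s = x ∧ σ.toFun t = y
  adj_sub h := h.1
  edge_vert := by
    rintro x y ⟨-, s, t, -, rfl, -⟩
    exact ⟨s, rfl⟩
  symm := ⟨by
    rintro x y ⟨h, s, t, hst, hs, ht⟩
    exact ⟨h.symm, t, s, hst.symm, ht, hs⟩⟩

end

/-! ### Quasimonophobic graphs -/

/-- An `n`-cube in `G`: a subgraph isomorphic to the discrete `n`-cube. -/
def IsCube {V : Type u} {G : SimpleGraph V} (n : ℕ) (Q : G.Subgraph) : Prop :=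
  Nonempty (cubeGraph n ≃g Q.coe)

/-- Whenever a noninjective singular `(n+1)`-cube has a face supported by `Q` (that is, with image
equal to `Q`), it has at least one further face supported by `Q`. -/
def IsQuasimonophobicCube {V : Type u} {G : SimpleGraph V} (n : ℕ) (Q : G.Subgraph) : Prop :=
  ∀ σ : SingularCube G (n + 1), ¬ Function.Injective σ.toFun →
    ∀ (i : Fin (n + 1)) (a : Bool), (SingularCube.face i a σ).image = Q →
      ∃ (j : Fin (n + 1)) (b : Bool), (j, b) ≠ (i, a) ∧ (SingularCube.face j b σ).image = Q

/-- Every `n`-cube in `G` is rigid (an induced subgraph) and quasimonophobic. -/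
def IsQuasimonophobic {V : Type u} (G : SimpleGraph V) (n : ℕ) : Prop :=
  ∀ Q : G.Subgraph, IsCube n Q → Q.IsInduced ∧ IsQuasimonophobicCube n Q

/-! ### The cubical boundary operator -/

/-- The sign attached to a value of a coordinate: `+1` for `0`, `-1` for `1`. -/
def bsign (a : Bool) : ℤ := if a then -1 else 1

section Boundary

variable {X Y Z : Type u} {n : ℕ}

/-- For a set `X` of `(n+1)`-cubes with front (`false`) and back (`true`) faces in `Y`, the map
`∂ σ = ∑ᵢ (-1)ⁱ (fᵢ⁻ σ - fᵢ⁺ σ)` between the free abelian groups, where `i` runs through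
`1, …, n + 1` (elements of `Fin (n + 1)` count from `0`, hence the shift in the exponent). -/
def boundary (face : Fin (n + 1) → Bool → X → Y) : (X →₀ ℤ) →ₗ[ℤ] (Y →₀ ℤ) :=
  Finsupp.linearCombination ℤ fun σ => ∑ i : Fin (n + 1), (-1 : ℤ) ^ ((i : ℕ) + 1) •
    (Finsupp.single (face i false σ) (1 : ℤ) - Finsupp.single (face i true σ) 1)

theorem boundary_single (face : Fin (n + 1) → Bool → X → Y) (σ : X) :
    boundary face (Finsupp.single σ 1) = ∑ i : Fin (n + 1), (-1 : ℤ) ^ ((i : ℕ) + 1) •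
      (Finsupp.single (face i false σ) (1 : ℤ) - Finsupp.single (face i true σ) 1) := by
  simp [boundary]

theorem boundary_single' (face : Fin (n + 1) → Bool → X → Y) (σ : X) :
    boundary face (Finsupp.single σ 1) = ∑ i : Fin (n + 1), ∑ a : Bool,
      ((-1 : ℤ) ^ ((i : ℕ) + 1) * bsign a) • Finsupp.single (face i a σ) (1 : ℤ) := by
  rw [boundary_single]
  refine Finset.sum_congr rfl fun i _ => ?_
  simp only [Fintype.sum_bool, bsign, smul_sub]
  simp only [if_true, Bool.false_eq_true, if_false, mul_neg, mul_one, neg_smul]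
  abel

theorem boundary_boundary (face : Fin (n + 2) → Bool → X → Y) (face' : Fin (n + 1) → Bool → Y → Z)
    (hface : ∀ (σ : X) (j : Fin (n + 2)) (i : Fin (n + 1)) (a b : Bool),
      face' i a (face j b σ) = face' (i.predAbove j) b (face (j.succAbove i) a σ)) :
    (boundary face').comp (boundary face) = 0 := by
  refine Finsupp.lhom_ext' fun σ => LinearMap.ext_ring ?_
  change boundary face' (boundary face (Finsupp.single σ 1)) = 0
  let f : (Fin (n + 2) × Bool) × (Fin (n + 1) × Bool) → Z →₀ ℤ := fun p =>
    ((-1 : ℤ) ^ ((p.1.1 : ℕ) + 1) * bsign p.1.2 *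
      ((-1 : ℤ) ^ ((p.2.1 : ℕ) + 1) * bsign p.2.2)) •
        Finsupp.single (face' p.2.1 p.2.2 (face p.1.1 p.1.2 σ)) (1 : ℤ)
  have h : boundary face' (boundary face (Finsupp.single σ 1)) = ∑ p, f p := by
    rw [boundary_single']
    simp only [map_sum, map_smul, boundary_single', Finset.smul_sum, smul_smul,
      Fintype.sum_prod_type, f]
  rw [h]
  refine Finset.sum_involution
    (fun p _ => ((p.1.1.succAbove p.2.1, p.2.2), (p.2.1.predAbove p.1.1, p.1.2))) ?_ ?_ ?_ ?_
  · rintro ⟨⟨j, b⟩, ⟨i, a⟩⟩ -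
    simp only [f, hface σ j i a b]
    rw [← add_smul]
    have hs := Fin.neg_one_pow_succAbove_add_predAbove (R := ℤ) j i
    have : (-1 : ℤ) ^ ((j : ℕ) + 1) * bsign b * ((-1) ^ ((i : ℕ) + 1) * bsign a) +
        (-1) ^ ((j.succAbove i : ℕ) + 1) * bsign a *
          ((-1) ^ ((i.predAbove j : ℕ) + 1) * bsign b) = 0 := by
      simp only [pow_add, pow_one] at hs ⊢
      linear_combination (bsign a * bsign b) * hs
    rw [this, zero_smul]
  · rintro ⟨⟨j, b⟩, ⟨i, a⟩⟩ - - he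
    have : j.succAbove i = j := congrArg (fun p => p.1.1) he
    exact Fin.succAbove_ne j i this
  · intros
    exact Finset.mem_univ _
  · rintro ⟨⟨j, b⟩, ⟨i, a⟩⟩ -
    simp [Fin.succAbove_succAbove_predAbove, Fin.predAbove_predAbove_succAbove]

end Boundary

/-! ### Discrete cubical homology -/

section Singular

variable {V : Type u} (G : SimpleGraph V) (n : ℕ)

/-- The boundary operator on the unnormalized singular cubical chains. -/
abbrev singularBoundary : (SingularCube G (n + 1) →₀ ℤ) →ₗ[ℤ] (SingularCube G n →₀ ℤ) :=
  boundary SingularCube.face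

/-- The span of the degenerate singular `n`-cubes. -/
def degenerateChains : Submodule ℤ (SingularCube G n →₀ ℤ) :=
  Submodule.span ℤ {c | ∃ σ : SingularCube G n, σ.IsDegenerate ∧ c = Finsupp.single σ 1}

variable {G n} in
theorem SingularCube.IsDegenerate.face_succAbove {σ : SingularCube G (n + 1)} (j : Fin (n + 1))
    (a : Bool) {k : Fin n}
    (h : ∀ t, σ.toFun (Function.update t (j.succAbove k) false) =
      σ.toFun (Function.update t (j.succAbove k) true)) :
    (SingularCube.face j a σ).IsDegenerate :=
  ⟨k, fun t => by simpa [SingularCube.face, Fin.insertNth_update] using h (j.insertNth a t)⟩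

theorem boundary_degenerate :
    degenerateChains G (n + 1) ≤
      (degenerateChains G n).comap (singularBoundary G n) := by
  refine Submodule.span_le.2 ?_
  rintro _ ⟨σ, ⟨i, hi⟩, rfl⟩
  rw [SetLike.mem_coe, Submodule.mem_comap, boundary_single]
  refine Submodule.sum_mem _ fun j _ => Submodule.smul_mem _ _ ?_
  rcases Fin.eq_self_or_eq_succAbove j i with rfl | ⟨k, rfl⟩
  · have : SingularCube.face i false σ = SingularCube.face i true σ := by
      ext t
      simpa [SingularCube.face] using hi (i.insertNth false t)
    simp [this]
  · exact Submodule.sub_mem _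
      (Submodule.subset_span ⟨_, SingularCube.IsDegenerate.face_succAbove j false hi, rfl⟩)
      (Submodule.subset_span ⟨_, SingularCube.IsDegenerate.face_succAbove j true hi, rfl⟩)

/-- Normalized singular cubical `n`-chains: all chains modulo degenerate ones. -/
abbrev NormalizedChains : Type u := (SingularCube G n →₀ ℤ) ⧸ degenerateChains G n

/-- The boundary operator on normalized chains. -/
def normalizedBoundary : NormalizedChains G (n + 1) →ₗ[ℤ] NormalizedChains G n :=
  Submodule.mapQ _ _ (singularBoundary G n) (boundary_degenerate G n)

theorem normalizedBoundary_comp :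
    (normalizedBoundary G n).comp (normalizedBoundary G (n + 1)) = 0 := by
  refine Submodule.linearMap_qext _ (LinearMap.ext fun c => ?_)
  have := LinearMap.congr_fun (boundary_boundary (SingularCube.face (G := G) (n := n + 1))
    SingularCube.face SingularCube.face_face) c
  simp only [LinearMap.comp_apply, LinearMap.zero_apply] at this
  simp [normalizedBoundary, this]

/-- The normalized singular cubical chain complex of `G`; its homology is the discrete cubical
homology of `G`. -/
def cubicalComplex : ChainComplex (ModuleCat.{u} ℤ) ℕ :=
  ChainComplex.of (fun n => ModuleCat.of ℤ (NormalizedChains G n))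
    (fun n => ModuleCat.ofHom (normalizedBoundary G n))
    (fun n => by rw [← ModuleCat.ofHom_comp, normalizedBoundary_comp]; rfl)

end Singular

/-! ### The cellular chain complex of the cubical CW complex

The `n`-cells of the cubical CW complex of `G` are the subgraphs of `G` isomorphic to the discrete
`n`-cube, filled in by solid cubes `[0,1]ⁿ`. The injective singular `n`-cubes `σ` are the
characteristic maps of these cells: `σ` parametrizes the cell `σ.image`, and the parametrizations
of one cell differ exactly by the symmetries of the cube, which are the signed permutations of the
coordinates. Thus a cell with an orientation is an injective singular cube up to symmetries that
preserve the orientation of `[0,1]ⁿ`, and the cellular chains are the free abelian group on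
oriented cells, where reversing the orientation is identified with changing the sign. -/

section Cellular

variable {V : Type u} {G : SimpleGraph V} {n : ℕ}

/-- The symmetry of `{0,1}ⁿ` that permutes the coordinates by `e` and flips those in `s`. -/
def cubeSymm (e : Equiv.Perm (Fin n)) (s : Fin n → Bool) (t : Fin n → Bool) : Fin n → Bool :=
  fun k => xor (t (e k)) (s k)

/-- The orientation character of the symmetry `cubeSymm e s`, that is, the determinant of its
linear part: the sign of `e` times `-1` for each flipped coordinate. -/
def orientationSign (e : Equiv.Perm (Fin n)) (s : Fin n → Bool) : ℤ :=
  (Equiv.Perm.sign e : ℤ) * ∏ k, bsign (s k)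

theorem cubeSymm_injective (e : Equiv.Perm (Fin n)) (s : Fin n → Bool) :
    Function.Injective (cubeSymm e s) := by
  intro x y h
  funext k
  have := congrFun h (e.symm k)
  simpa [cubeSymm] using this

theorem cubeGraph_adj_cubeSymm (e : Equiv.Perm (Fin n)) (s : Fin n → Bool) {x y : Fin n → Bool}
    (h : (cubeGraph n).Adj x y) : (cubeGraph n).Adj (cubeSymm e s x) (cubeSymm e s y) := by
  obtain ⟨k, hk, hu⟩ := h
  refine ⟨e.symm k, by simpa [cubeSymm] using hk, fun j hj => ?_⟩
  rw [← hu (e j) (by simpa [cubeSymm] using hj), Equiv.symm_apply_apply]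

/-- Precomposition of a singular cube with a symmetry of the discrete cube. -/
def SingularCube.precomp (σ : SingularCube G n) (e : Equiv.Perm (Fin n)) (s : Fin n → Bool) :
    SingularCube G n where
  toFun t := σ.toFun (cubeSymm e s t)
  map_adj h := σ.map_adj (cubeGraph_adj_cubeSymm e s h)

variable (G n) in
/-- The characteristic maps of the `n`-cells: injective singular `n`-cubes. -/
abbrev CubeChart : Type u := {σ : SingularCube G n // Function.Injective σ.toFun}

/-- The characteristic map of a face of a cell. -/
def CubeChart.face (i : Fin (n + 1)) (a : Bool) (σ : CubeChart G (n + 1)) : CubeChart G n :=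
  ⟨SingularCube.face i a σ.1, σ.2.comp (Fin.insertNth_right_injective (α := fun _ => Bool) a)⟩

/-- Reparametrization of a cell by a symmetry of the cube. -/
def CubeChart.precomp (σ : CubeChart G n) (e : Equiv.Perm (Fin n)) (s : Fin n → Bool) :
    CubeChart G n :=
  ⟨SingularCube.precomp σ.1 e s, σ.2.comp (cubeSymm_injective e s)⟩

theorem CubeChart.face_face (σ : CubeChart G (n + 2)) (j : Fin (n + 2)) (i : Fin (n + 1))
    (a b : Bool) :
    face i a (face j b σ) = face (i.predAbove j) b (face (j.succAbove i) a σ) :=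
  Subtype.ext (SingularCube.face_face σ.1 j i a b)

variable (G n) in
/-- The boundary operator on parametrized cells. -/
abbrev chartBoundary : (CubeChart G (n + 1) →₀ ℤ) →ₗ[ℤ] (CubeChart G n →₀ ℤ) :=
  boundary CubeChart.face

variable (G n) in
/-- The span of the relations `σ ∘ T = ± σ`, where `T` is a symmetry of the `n`-cube and the sign
says whether `T` preserves or reverses the orientation. -/
def orientationRelations : Submodule ℤ (CubeChart G n →₀ ℤ) :=
  Submodule.span ℤ {c | ∃ (σ : CubeChart G n) (e : Equiv.Perm (Fin n)) (s : Fin n → Bool),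
    c = Finsupp.single (σ.precomp e s) 1 - orientationSign e s • Finsupp.single σ (1 : ℤ)}

theorem exists_restrict_perm (e : Equiv.Perm (Fin (n + 1))) (k : Fin (n + 1)) :
    ∃ e' : Equiv.Perm (Fin n), (∀ j, e (k.succAbove j) = (e k).succAbove (e' j)) ∧
      (Equiv.Perm.sign e : ℤ) = (-1) ^ ((k : ℕ) + (e k : ℕ)) * (Equiv.Perm.sign e' : ℤ) := by
  set f : Equiv.Perm (Fin (n + 1)) := (e k).cycleRange * e * k.cycleRange⁻¹ with hf
  obtain ⟨⟨p, e'⟩, hp⟩ := Equiv.Perm.decomposeFin.symm.surjective f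
  have hk : k.cycleRange⁻¹ 0 = k := Fin.cycleRange_symm_zero k
  have hf0 : f 0 = 0 := by
    simp only [hf, Equiv.Perm.mul_apply, hk, Fin.cycleRange_self]
  have hp0 : p = 0 := by
    rw [← hf0, ← hp, Equiv.Perm.decomposeFin_symm_apply_zero]
  subst hp0
  refine ⟨e', fun j => ?_, ?_⟩
  · have h1 : f j.succ = (e' j).succ := by
      rw [← hp, Equiv.Perm.decomposeFin_symm_apply_succ]
      simp
    have h2 : k.cycleRange⁻¹ j.succ = k.succAbove j := Fin.cycleRange_symm_succ k j
    simp only [hf, Equiv.Perm.mul_apply, h2] at h1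
    rw [← Fin.cycleRange_symm_succ (e k), ← h1, Equiv.symm_apply_apply]
  · have h1 : Equiv.Perm.sign f = Equiv.Perm.sign e' := by
      rw [← hp, Equiv.Perm.decomposeFin.symm_sign]
      simp
    rw [← h1, hf]
    simp only [Equiv.Perm.sign_mul, Equiv.Perm.sign_inv, Fin.sign_cycleRange]
    push_cast
    have h2 : ((-1 : ℤ) ^ (k : ℕ)) * (-1) ^ (k : ℕ) = 1 := by rw [← mul_pow]; simp
    have h3 : ((-1 : ℤ) ^ (e k : ℕ)) * (-1) ^ (e k : ℕ) = 1 := by rw [← mul_pow]; simp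
    rw [pow_add]
    linear_combination (-(Equiv.Perm.sign e : ℤ)) * ((-1) ^ (e k : ℕ) * (-1) ^ (e k : ℕ)) * h2 -
      (Equiv.Perm.sign e : ℤ) * h3

theorem CubeChart.face_precomp (σ : CubeChart G (n + 1)) (e : Equiv.Perm (Fin (n + 1)))
    (s : Fin (n + 1) → Bool) (k : Fin (n + 1)) (e' : Equiv.Perm (Fin n))
    (h : ∀ j, e (k.succAbove j) = (e k).succAbove (e' j)) (a : Bool) :
    CubeChart.face (e k) a (σ.precomp e s) =
      (CubeChart.face k (xor a (s k)) σ).precomp e' (fun j => s (k.succAbove j)) := by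
  refine Subtype.ext (GraphMap.ext (funext fun t => ?_))
  change σ.1.toFun _ = σ.1.toFun _
  congr 1
  symm
  rw [Fin.insertNth_eq_iff]
  refine ⟨by simp [cubeSymm], funext fun j => ?_⟩
  simp [Fin.removeNth, cubeSymm, h]

theorem boundary_precomp (σ : CubeChart G (n + 1)) (e : Equiv.Perm (Fin (n + 1)))
    (s : Fin (n + 1) → Bool) :
    chartBoundary G n (Finsupp.single (σ.precomp e s) 1 -
      orientationSign e s • Finsupp.single σ (1 : ℤ)) ∈ orientationRelations G n := by
  rw [map_sub, map_smul]
  rw [boundary_single', boundary_single']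
  rw [← Equiv.sum_comp e, Finset.smul_sum, ← Finset.sum_sub_distrib]
  refine Submodule.sum_mem _ fun k _ => ?_
  obtain ⟨e', he', hsign⟩ := exists_restrict_perm e k
  have hk : ∀ a, CubeChart.face (e k) a (σ.precomp e s) =
      (CubeChart.face k (xor a (s k)) σ).precomp e' (fun j => s (k.succAbove j)) :=
    CubeChart.face_precomp σ e s k e' he'
  have hb : ∀ a b, bsign (xor a b) = bsign a * bsign b := by decide
  have hbb : ∀ b, bsign b * bsign b = 1 := by decide
  let E : Equiv.Perm Bool := ⟨fun a => xor a (s k), fun a => xor a (s k), fun a => by simp,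
    fun a => by simp⟩
  rw [← Equiv.sum_comp E (fun a : Bool => ((-1 : ℤ) ^ ((k : ℕ) + 1) * bsign a) •
    Finsupp.single (CubeChart.face k a σ) (1 : ℤ)), Finset.smul_sum,
    ← Finset.sum_sub_distrib]
  refine Submodule.sum_mem _ fun a _ => ?_
  rw [hk, smul_smul]
  have hc : orientationSign e s * ((-1 : ℤ) ^ ((k : ℕ) + 1) * bsign (E a)) =
      ((-1 : ℤ) ^ ((e k : ℕ) + 1) * bsign a) *
        orientationSign e' (fun j => s (k.succAbove j)) := by
    simp only [orientationSign, hsign, Fin.prod_univ_succAbove _ k]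
    change _ * ((-1 : ℤ) ^ ((k : ℕ) + 1) * bsign (xor a (s k))) = _
    rw [hb]
    have h2 : ((-1 : ℤ) ^ (k : ℕ)) * (-1) ^ (k : ℕ) = 1 := by rw [← mul_pow]; simp
    simp only [pow_add, pow_one]
    linear_combination (-(-1 : ℤ) ^ (e k : ℕ) * (Equiv.Perm.sign e' : ℤ) *
      (∏ j, bsign (s (k.succAbove j))) * bsign a) *
        ((bsign (s k) * bsign (s k)) * h2 + hbb (s k))
  rw [hc, mul_smul ((-1 : ℤ) ^ ((e k : ℕ) + 1) * bsign a) (orientationSign _ _), ← smul_sub]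
  exact Submodule.smul_mem _ _ (Submodule.subset_span ⟨_, _, _, rfl⟩)

variable (G n)

theorem boundary_orientationRelations :
    orientationRelations G (n + 1) ≤
      (orientationRelations G n).comap (chartBoundary G n) := by
  refine Submodule.span_le.2 ?_
  rintro _ ⟨σ, e, s, rfl⟩
  exact boundary_precomp σ e s

/-- Cellular `n`-chains of the cubical CW complex of `G`: a free abelian group which has one
generator, well defined up to sign, for each subgraph of `G` isomorphic to the `n`-cube. -/
abbrev CellularChains : Type u := (CubeChart G n →₀ ℤ) ⧸ orientationRelations G n

/-- The cellular boundary: a cell goes to the sum of its codimension one faces with their induced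
orientations. -/
def cellularBoundary : CellularChains G (n + 1) →ₗ[ℤ] CellularChains G n :=
  Submodule.mapQ _ _ (chartBoundary G n) (boundary_orientationRelations G n)

theorem cellularBoundary_comp :
    (cellularBoundary G n).comp (cellularBoundary G (n + 1)) = 0 := by
  refine Submodule.linearMap_qext _ (LinearMap.ext fun c => ?_)
  have := LinearMap.congr_fun (boundary_boundary (CubeChart.face (G := G) (n := n + 1))
    CubeChart.face CubeChart.face_face) c
  simp only [LinearMap.comp_apply, LinearMap.zero_apply] at this
  simp [cellularBoundary, this]

/-- The cellular chain complex of the cubical CW complex of `G`. -/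
def cellularComplex : ChainComplex (ModuleCat.{u} ℤ) ℕ :=
  ChainComplex.of (fun n => ModuleCat.of ℤ (CellularChains G n))
    (fun n => ModuleCat.ofHom (cellularBoundary G n))
    (fun n => by rw [← ModuleCat.ofHom_comp, cellularBoundary_comp]; rfl)

end Cellular

/-! ### The injective part of a chain -/

section InjectivePart

variable {V : Type u} (G : SimpleGraph V) (n : ℕ)

open Classical in
/-- An injective singular cube goes to the oriented cell it parametrizes, a noninjective one
to zero. -/
def injectivePartAux : (SingularCube G n →₀ ℤ) →ₗ[ℤ] CellularChains G n :=
  Finsupp.linearCombination ℤ fun σ : SingularCube G n =>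
    if h : Function.Injective σ.toFun then
      (orientationRelations G n).mkQ (Finsupp.single (⟨σ, h⟩ : CubeChart G n) 1)
    else 0

theorem degenerateChains_le_ker : degenerateChains G n ≤ LinearMap.ker (injectivePartAux G n) := by
  refine Submodule.span_le.2 ?_
  rintro _ ⟨σ, ⟨i, hi⟩, rfl⟩
  have hσ : ¬ Function.Injective σ.toFun := fun h => by
    have := congrFun (h (hi fun _ => false)) i
    simp at this
  rw [SetLike.mem_coe, LinearMap.mem_ker, injectivePartAux, Finsupp.linearCombination_single,
    dif_neg hσ, smul_zero]

/-- The map from normalized singular cubical `n`-chains to cellular `n`-chains which keeps the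
injective singular cubes and discards the noninjective ones. It is not a chain map in general. -/
def injectivePart : (cubicalComplex G).X n ⟶ (cellularComplex G).X n :=
  ModuleCat.ofHom ((degenerateChains G n).liftQ (injectivePartAux G n)
    (degenerateChains_le_ker G n))

end InjectivePart

end DiscreteCubical

end

noncomputable section

namespace DiscreteCubical

/-! Write [abcd] for the singular square with the vertices a, b, c, d at 00, 01, 10, 11, and π for
`injectivePartAux`, which is surjective in every degree. It suffices that π commutes with the
boundary between degrees 3, 2, 1, and that its kernel is acyclic, modulo degenerate chains, in
degrees 2 and 1; lifting and correcting chains as in the long exact sequence then gives the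
isomorphism.

The hypothesis in dimension 1 enters through the absence of triangles
(`IsQuasimonophobic.triangleFree`).

Kernel. Modulo boundaries and degenerate chains, exchanging coordinates negates a square, but
reflecting it does so only up to squares [aaba] folded along an edge. These are not cycles, so they
cannot be expected to vanish. However, the class of [aaba] can be read off from its boundary: choose
one direction for every edge, and let `foldEdge` send the chosen direction of ab to the class of
[aaba] and the opposite one to 0. The chains whose class is `foldEdge` of their boundary form the
submodule `foldChains`. It contains every noninjective square of a triangle-free graph and all
symmetry relations, hence the kernel of π; and a cycle in it is a boundary
(`mem_boundaryChains_of_injectivePartAux_eq_zero`). In degree 1 the folded squares themselves bound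
the kernel (`ker_injectivePartAux_one_le`).

Chain map. The boundary of a noninjective 2- or 3-cube must have no injective part. In dimension 3 a
symmetry moves two coinciding vertices to 000 and 001, 011 or 111; the last case reduces to a
shorter coincidence, as there are no triangles. In the other two the faces cancel in pairs, vanish,
or form a theta: three squares with two common opposite corners and three middle vertices. A theta
sums to zero as soon as two middle vertices agree (`IsAlternating.theta`), and quasimonophobia in
dimension 2 rules out thetas with distinct vertices. -/

section Squares

variable {V : Type u} {G : SimpleGraph V}

/-! ### Singular cubes of dimension at most 3 described by their vertices -/

variable (G) in
/-- Two vertices which are equal or adjacent. -/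
def Near (x y : V) : Prop := x = y ∨ G.Adj x y

theorem Near.refl (x : V) : Near G x x := Or.inl rfl

theorem Near.symm {x y : V} (h : Near G x y) : Near G y x :=
  h.imp Eq.symm SimpleGraph.Adj.symm

theorem near_comm {x y : V} : Near G x y ↔ Near G y x := ⟨Near.symm, Near.symm⟩

theorem SingularCube.near {n : ℕ} (σ : SingularCube G n) {x y : Fin n → Bool}
    (h : (cubeGraph n).Adj x y) : Near G (σ.toFun x) (σ.toFun y) := σ.map_adj h

/-- A triangle-free graph, phrased for vertices which may coincide. -/
def TriangleFree (G : SimpleGraph V) : Prop :=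
  ∀ x y z, Near G x y → Near G y z → Near G x z → x = y ∨ y = z ∨ x = z

/-- The singular `1`-cube with the given vertices. -/
def edge (a b : V) (h : Near G a b) : SingularCube G 1 where
  toFun x := bif x 0 then b else a
  map_adj := by
    rintro x y ⟨k, hk, -⟩
    fin_cases k
    revert hk
    change x 0 ≠ y 0 → Near G _ _
    have := h.symm
    cases x 0 <;> cases y 0 <;> simp [Near.refl, *]

/-- The singular `2`-cube with vertices `a, b, c, d` at `00, 01, 10, 11`. -/
def square (a b c d : V) (h : Near G a b ∧ Near G a c ∧ Near G b d ∧ Near G c d) :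
    SingularCube G 2 where
  toFun x := bif x 0 then (bif x 1 then d else c) else (bif x 1 then b else a)
  map_adj := by
    rintro x y ⟨k, hk, hu⟩
    obtain ⟨h1, h2, h3, h4⟩ := h
    have h1' := h1.symm
    have h2' := h2.symm
    have h3' := h3.symm
    have h4' := h4.symm
    replace hu : ∀ j, j ≠ k → x j = y j := fun j hj => by_contra fun h => hj (hu j h)
    change Near G _ _
    fin_cases k
    · rw [hu 1 (by decide)]
      cases x 0 <;> cases y 0 <;> cases y 1 <;> simp [Near.refl, *]
    · rw [hu 0 (by decide)]
      cases x 1 <;> cases y 1 <;> cases y 0 <;> simp [Near.refl, *]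

/-- The singular `3`-cube with the given vertices. -/
def hexahedron (v : Bool → Bool → Bool → V) (h0 : ∀ j k, Near G (v false j k) (v true j k))
    (h1 : ∀ i k, Near G (v i false k) (v i true k))
    (h2 : ∀ i j, Near G (v i j false) (v i j true)) : SingularCube G 3 where
  toFun x := v (x 0) (x 1) (x 2)
  map_adj := by
    rintro x y ⟨k, hk, hu⟩
    have h0' := fun j k => (h0 j k).symm
    have h1' := fun j k => (h1 j k).symm
    have h2' := fun j k => (h2 j k).symm
    replace hu : ∀ j, j ≠ k → x j = y j := fun j hj => by_contra fun h => hj (hu j h)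
    change Near G _ _
    fin_cases k
    · rw [hu 1 (by decide), hu 2 (by decide)]
      cases x 0 <;> cases y 0 <;> simp [Near.refl, *]
    · rw [hu 0 (by decide), hu 2 (by decide)]
      cases x 1 <;> cases y 1 <;> simp [Near.refl, *]
    · rw [hu 0 (by decide), hu 1 (by decide)]
      cases x 2 <;> cases y 2 <;> simp [Near.refl, *]

variable (G) in
open Classical in
/-- The generator of the singular `1`-chains given by a pair of vertices, zero if there is none. -/
def edgeChain (a b : V) : SingularCube G 1 →₀ ℤ :=
  if h : Near G a b then Finsupp.single (edge a b h) 1 else 0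

variable (G) in
open Classical in
/-- The generator of the singular `2`-chains given by its vertices, zero if there is none. -/
def squareChain (a b c d : V) : SingularCube G 2 →₀ ℤ :=
  if h : Near G a b ∧ Near G a c ∧ Near G b d ∧ Near G c d then
    Finsupp.single (square a b c d h) 1 else 0

theorem vec_one (x : Fin 1 → Bool) : x = ![x 0] := by
  funext i; fin_cases i; rfl

theorem vec_two (x : Fin 2 → Bool) : x = ![x 0, x 1] := by
  funext i; fin_cases i <;> rfl

theorem adj_one : (cubeGraph 1).Adj ![false] ![true] :=
  ⟨0, by decide, by decide⟩

theorem adj_two (a : Bool) : (cubeGraph 2).Adj ![a, false] ![a, true] :=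
  ⟨1, by decide +revert, by decide +revert⟩

theorem adj_two' (a : Bool) : (cubeGraph 2).Adj ![false, a] ![true, a] :=
  ⟨0, by decide +revert, by decide +revert⟩

theorem single_eq_edgeChain (τ : SingularCube G 1) :
    Finsupp.single τ (1 : ℤ) = edgeChain G (τ.toFun ![false]) (τ.toFun ![true]) := by
  rw [edgeChain, dif_pos (τ.near adj_one)]
  congr 1
  ext x
  rw [vec_one x]
  cases h : x 0 <;> simp [edge]

theorem single_eq_squareChain (τ : SingularCube G 2) :
    Finsupp.single τ (1 : ℤ) = squareChain G (τ.toFun ![false, false]) (τ.toFun ![false, true])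
      (τ.toFun ![true, false]) (τ.toFun ![true, true]) := by
  rw [squareChain, dif_pos ⟨τ.near (adj_two _), τ.near (adj_two' _), τ.near (adj_two' _),
    τ.near (adj_two _)⟩]
  congr 1
  ext x
  rw [vec_two x]
  cases h : x 0 <;> cases h' : x 1 <;> simp [square]

theorem insertNth_two (a i : Bool) :
    ((0 : Fin 2).insertNth a ![i] : Fin 2 → Bool) = ![a, i] ∧
    ((1 : Fin 2).insertNth a ![i] : Fin 2 → Bool) = ![i, a] := by
  decide +revert

theorem insertNth_three (a i j : Bool) :
    ((0 : Fin 3).insertNth a ![i, j] : Fin 3 → Bool) = ![a, i, j] ∧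
    ((1 : Fin 3).insertNth a ![i, j] : Fin 3 → Bool) = ![i, a, j] ∧
    ((2 : Fin 3).insertNth a ![i, j] : Fin 3 → Bool) = ![i, j, a] := by
  decide +revert

theorem boundary_two (σ : SingularCube G 2) :
    singularBoundary G 1 (Finsupp.single σ 1) =
      - edgeChain G (σ.toFun ![false, false]) (σ.toFun ![false, true])
      + edgeChain G (σ.toFun ![true, false]) (σ.toFun ![true, true])
      + edgeChain G (σ.toFun ![false, false]) (σ.toFun ![true, false])
      - edgeChain G (σ.toFun ![false, true]) (σ.toFun ![true, true]) := by
  rw [boundary_single, Fin.sum_univ_two]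
  simp only [single_eq_edgeChain, SingularCube.face, insertNth_two]
  norm_num
  abel

theorem boundary_three (σ : SingularCube G 3) :
    singularBoundary G 2 (Finsupp.single σ 1) =
      - squareChain G (σ.toFun ![false, false, false]) (σ.toFun ![false, false, true])
          (σ.toFun ![false, true, false]) (σ.toFun ![false, true, true])
      + squareChain G (σ.toFun ![true, false, false]) (σ.toFun ![true, false, true])
          (σ.toFun ![true, true, false]) (σ.toFun ![true, true, true])
      + squareChain G (σ.toFun ![false, false, false]) (σ.toFun ![false, false, true])
          (σ.toFun ![true, false, false]) (σ.toFun ![true, false, true])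
      - squareChain G (σ.toFun ![false, true, false]) (σ.toFun ![false, true, true])
          (σ.toFun ![true, true, false]) (σ.toFun ![true, true, true])
      - squareChain G (σ.toFun ![false, false, false]) (σ.toFun ![false, true, false])
          (σ.toFun ![true, false, false]) (σ.toFun ![true, true, false])
      + squareChain G (σ.toFun ![false, false, true]) (σ.toFun ![false, true, true])
          (σ.toFun ![true, false, true]) (σ.toFun ![true, true, true]) := by
  rw [boundary_single, Fin.sum_univ_three]
  simp only [single_eq_squareChain, SingularCube.face, insertNth_three]
  norm_num
  abel

theorem boundary_squareChain {a b c d : V} (hab : Near G a b) (hac : Near G a c)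
    (hbd : Near G b d) (hcd : Near G c d) :
    singularBoundary G 1 (squareChain G a b c d) =
      - edgeChain G a b + edgeChain G c d + edgeChain G a c - edgeChain G b d := by
  rw [squareChain, dif_pos ⟨hab, hac, hbd, hcd⟩, boundary_two]
  simp [square]

theorem edgeChain_self_mem (a : V) : edgeChain G a a ∈ degenerateChains G 1 := by
  rw [edgeChain, dif_pos (Near.refl a)]
  refine Submodule.subset_span ⟨_, ⟨0, fun t => ?_⟩, rfl⟩
  simp [edge]

theorem squareChain_mem_of_eq {a b : V} :
    squareChain G a a b b ∈ degenerateChains G 2 := by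
  rw [squareChain]
  split_ifs with h
  · refine Submodule.subset_span ⟨_, ⟨1, fun t => ?_⟩, rfl⟩
    simp [square]
  · exact Submodule.zero_mem _

theorem squareChain_mem_of_eq' {a b : V} :
    squareChain G a b a b ∈ degenerateChains G 2 := by
  rw [squareChain]
  split_ifs with h
  · refine Submodule.subset_span ⟨_, ⟨0, fun t => ?_⟩, rfl⟩
    simp [square]
  · exact Submodule.zero_mem _

/-! ### Relations between singular squares modulo boundaries and degenerate chains -/

variable (G) in
/-- Boundaries and degenerate chains. -/
def boundaryChains : Submodule ℤ (SingularCube G 2 →₀ ℤ) :=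
  LinearMap.range (singularBoundary G 2) ⊔ degenerateChains G 2

variable (G) in
/-- The class of a singular square modulo boundaries and degenerate chains. -/
def squareClass (a b c d : V) : (SingularCube G 2 →₀ ℤ) ⧸ boundaryChains G :=
  (boundaryChains G).mkQ (squareChain G a b c d)

theorem squareClass_eq_zero_of_eq (a b : V) : squareClass G a a b b = 0 :=
  (Submodule.Quotient.mk_eq_zero _).2 (Submodule.mem_sup_right squareChain_mem_of_eq)

theorem squareClass_eq_zero_of_eq' (a b : V) : squareClass G a b a b = 0 :=
  (Submodule.Quotient.mk_eq_zero _).2 (Submodule.mem_sup_right squareChain_mem_of_eq')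

theorem squareClass_hexahedron (v : Bool → Bool → Bool → V)
    (h0 : ∀ j k, Near G (v false j k) (v true j k))
    (h1 : ∀ i k, Near G (v i false k) (v i true k))
    (h2 : ∀ i j, Near G (v i j false) (v i j true)) :
    - squareClass G (v false false false) (v false false true)
        (v false true false) (v false true true)
      + squareClass G (v true false false) (v true false true)
        (v true true false) (v true true true)
      + squareClass G (v false false false) (v false false true)
        (v true false false) (v true false true)
      - squareClass G (v false true false) (v false true true)
        (v true true false) (v true true true)
      - squareClass G (v false false false) (v false true false)
        (v true false false) (v true true false)
      + squareClass G (v false false true) (v false true true)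
        (v true false true) (v true true true) = 0 := by
  simp only [squareClass, ← map_neg, ← map_add, ← map_sub]
  refine (Submodule.Quotient.mk_eq_zero _).2 (Submodule.mem_sup_left
    ⟨Finsupp.single (hexahedron v h0 h1 h2) 1, ?_⟩)
  rw [boundary_three]
  simp [hexahedron]

/-- The vertices of a `3`-cube as a function of its coordinates. -/
def corners (a b c d a' b' c' d' : V) (i j k : Bool) : V :=
  bif i then (bif j then (bif k then d' else c') else (bif k then b' else a'))
    else (bif j then (bif k then d else c) else (bif k then b else a))

variable {a b c d : V}

/-- The relation is the boundary of the cube whose value at (i, j, k) is that of the square at (i ∧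
¬j, k). The two folded squares on the right are the faces k = 0 and k = 1. -/
theorem squareClass_flip_left (hab : Near G a b) (hac : Near G a c)
    (hbd : Near G b d) (hcd : Near G c d) :
    squareClass G a b c d + squareClass G c d a b =
      squareClass G a a c a - squareClass G b b d b := by
  have := squareClass_hexahedron (G := G) (corners a b a b c d a b)
    (by simp [corners, Near.refl, *]) (by simp [corners, Near.refl, Near.symm, *])
    (by simp [corners, *])
  simp only [corners, cond_true, cond_false, squareClass_eq_zero_of_eq'] at this
  rw [← sub_eq_zero, ← this]
  abel

theorem squareClass_flip_right (hab : Near G a b) (hac : Near G a c)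
    (hbd : Near G b d) (hcd : Near G c d) :
    squareClass G a b c d + squareClass G b a d c =
      squareClass G c c d c - squareClass G a a b a := by
  have := squareClass_hexahedron (G := G) (corners a a b a c c d c)
    (by simp [corners, *]) (by simp [corners, Near.refl, Near.symm, *])
    (by simp [corners, Near.refl, Near.symm, *])
  simp only [corners, cond_true, cond_false, squareClass_eq_zero_of_eq] at this
  rw [← sub_eq_zero, ← neg_eq_zero, ← this]
  abel

/-- Here the cube takes at (i, j, k) the value of the square at (j, i ∨ k). -/
theorem squareClass_swap_aux (hab : Near G a b) (hac : Near G a c)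
    (hbd : Near G b d) (hcd : Near G c d) :
    squareClass G a b c d + squareClass G a c b d =
      squareClass G a b b b - squareClass G c d d d := by
  have := squareClass_hexahedron (G := G) (corners a b c d b b d d)
    (by simp [corners, Near.refl, *]) (by simp [corners, *])
    (by simp [corners, Near.refl, *])
  simp only [corners, cond_true, cond_false, squareClass_eq_zero_of_eq,
    squareClass_eq_zero_of_eq'] at this
  rw [← sub_eq_zero, ← neg_eq_zero, ← this]
  abel

/-- Applied to [abbb] itself, `squareClass_swap_aux` says that twice the class equals the class. -/
theorem squareClass_connection (hab : Near G a b) : squareClass G a b b b = 0 := by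
  have := squareClass_swap_aux hab hab (Near.refl b) (Near.refl b)
  rwa [squareClass_eq_zero_of_eq, sub_zero, add_eq_left] at this

theorem squareClass_swap (hab : Near G a b) (hac : Near G a c)
    (hbd : Near G b d) (hcd : Near G c d) :
    squareClass G a c b d = - squareClass G a b c d := by
  have := squareClass_swap_aux hab hac hbd hcd
  rw [squareClass_connection hab, squareClass_connection hcd, sub_zero] at this
  exact eq_neg_of_add_eq_zero_right this

/-- The class of a folded square does not depend on the end at which the fold starts, so it belongs
to the unoriented edge. -/
theorem squareClass_back_comm (hab : Near G a b) :
    squareClass G a a b a = squareClass G b b a b := by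
  have := squareClass_flip_left hab hab (Near.refl b) (Near.refl b)
  rw [squareClass_connection hab, squareClass_eq_zero_of_eq b b, sub_zero, zero_add] at this
  exact this.symm

theorem squareClass_fold (hab : Near G a b) (hbd : Near G b d) :
    squareClass G a b b d = 0 := by
  have := squareClass_hexahedron (G := G) (corners a b b d b b b b)
    (by simp [corners, Near.refl, Near.symm, *]) (by simp [corners, Near.refl, *])
    (by simp [corners, Near.refl, *])
  simp only [corners, cond_true, cond_false, squareClass_eq_zero_of_eq,
    squareClass_connection hab] at this
  rw [← neg_eq_zero, ← this]
  abel

end Squares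

/-! ### The kernel of the injective part -/

section Kernel

variable {V : Type u} {G : SimpleGraph V} {n : ℕ}

theorem injectivePartAux_of_injective {σ : SingularCube G n} (h : Function.Injective σ.toFun) :
    injectivePartAux G n (Finsupp.single σ 1) =
      (orientationRelations G n).mkQ (Finsupp.single (⟨σ, h⟩ : CubeChart G n) 1) := by
  rw [injectivePartAux, Finsupp.linearCombination_single, dif_pos h, one_smul]

theorem injectivePartAux_of_not_injective {σ : SingularCube G n}
    (h : ¬ Function.Injective σ.toFun) :
    injectivePartAux G n (Finsupp.single σ 1) = 0 := by
  rw [injectivePartAux, Finsupp.linearCombination_single, dif_neg h, smul_zero]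

theorem cubeSymm_surjective (e : Equiv.Perm (Fin n)) (s : Fin n → Bool) :
    Function.Surjective (cubeSymm e s) :=
  Finite.surjective_of_injective (cubeSymm_injective e s)

theorem SingularCube.precomp_injective_iff (σ : SingularCube G n) (e : Equiv.Perm (Fin n))
    (s : Fin n → Bool) :
    Function.Injective (σ.precomp e s).toFun ↔ Function.Injective σ.toFun := by
  refine ⟨fun h => ?_, fun h => h.comp (cubeSymm_injective e s)⟩
  exact Function.Injective.of_comp_right h (cubeSymm_surjective e s)

theorem injectivePartAux_precomp (σ : SingularCube G n) (e : Equiv.Perm (Fin n))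
    (s : Fin n → Bool) :
    injectivePartAux G n (Finsupp.single (σ.precomp e s) 1) =
      orientationSign e s • injectivePartAux G n (Finsupp.single σ 1) := by
  by_cases h : Function.Injective σ.toFun
  · rw [injectivePartAux_of_injective h,
      injectivePartAux_of_injective ((σ.precomp_injective_iff e s).2 h), ← map_smul,
      ← sub_eq_zero, ← map_sub]
    exact (Submodule.Quotient.mk_eq_zero _).2 (Submodule.subset_span ⟨⟨σ, h⟩, e, s, rfl⟩)
  · rw [injectivePartAux_of_not_injective h, injectivePartAux_of_not_injective
      (mt (σ.precomp_injective_iff e s).1 h), smul_zero]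

theorem injectivePartAux_surjective : Function.Surjective (injectivePartAux G n) := by
  rw [← LinearMap.range_eq_top, eq_top_iff]
  rintro y -
  obtain ⟨c, rfl⟩ := Submodule.mkQ_surjective _ y
  induction c using Finsupp.induction_linear with
  | zero => simp
  | add f g hf hg => rw [map_add]; exact Submodule.add_mem _ hf hg
  | single τ k =>
    rw [← mul_one k, ← smul_eq_mul, ← Finsupp.smul_single, map_smul]
    exact Submodule.smul_mem _ _ ⟨_, injectivePartAux_of_injective τ.2⟩

/-- The kernel is spanned by the noninjective cubes and the orientation relations. Under the two
hypotheses the projection modulo `P` factors through the cellular chains, via the map `r`. -/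
theorem ker_injectivePartAux_le {P : Submodule ℤ (SingularCube G n →₀ ℤ)}
    (h : ∀ σ : SingularCube G n, ¬ Function.Injective σ.toFun → Finsupp.single σ 1 ∈ P)
    (h' : ∀ (σ : SingularCube G n) (e : Equiv.Perm (Fin n)) (s : Fin n → Bool),
      P.mkQ (Finsupp.single (σ.precomp e s) 1) =
        orientationSign e s • P.mkQ (Finsupp.single σ 1)) :
    LinearMap.ker (injectivePartAux G n) ≤ P := by
  let ι : (CubeChart G n →₀ ℤ) →ₗ[ℤ] (SingularCube G n →₀ ℤ) :=
    Finsupp.lmapDomain ℤ ℤ Subtype.val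
  have hι : ∀ τ, ι (Finsupp.single τ 1) = Finsupp.single τ.1 1 := fun τ => by simp [ι]
  let r : CellularChains G n →ₗ[ℤ] ((SingularCube G n →₀ ℤ) ⧸ P) :=
    (orientationRelations G n).liftQ (P.mkQ.comp ι) (Submodule.span_le.2 (by
      rintro _ ⟨τ, e, s, rfl⟩
      rw [SetLike.mem_coe, LinearMap.mem_ker, LinearMap.comp_apply, map_sub, map_smul, hι, hι,
        map_sub, map_smul, sub_eq_zero]
      exact h' τ.1 e s))
  have hr : r.comp (injectivePartAux G n) = P.mkQ := by
    refine Finsupp.lhom_ext' fun σ => LinearMap.ext_ring ?_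
    change r (injectivePartAux G n (Finsupp.single σ 1)) = P.mkQ (Finsupp.single σ 1)
    by_cases hσ : Function.Injective σ.toFun
    · rw [injectivePartAux_of_injective hσ]
      change P.mkQ (ι _) = _
      rw [hι]
    · rw [injectivePartAux_of_not_injective hσ, map_zero]
      exact ((Submodule.Quotient.mk_eq_zero _).2 (h σ hσ)).symm
  intro c hc
  rw [← P.ker_mkQ, LinearMap.mem_ker, ← hr, LinearMap.comp_apply, LinearMap.mem_ker.1 hc, map_zero]

end Kernel

/-! ### Consequences of quasimonophobia -/

section Quasimonophobic

variable {V : Type u} {G : SimpleGraph V} {n : ℕ}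

theorem isCube_image {σ : SingularCube G n} (h : Function.Injective σ.toFun) :
    IsCube n σ.image := by
  refine ⟨⟨Equiv.ofInjective σ.toFun h, ?_⟩⟩
  intro s t
  change (G.Adj (σ.toFun s) (σ.toFun t) ∧ ∃ s' t', (cubeGraph n).Adj s' t' ∧
    σ.toFun s' = σ.toFun s ∧ σ.toFun t' = σ.toFun t) ↔ _
  constructor
  · rintro ⟨-, s', t', hst, hs, ht⟩
    rwa [← h hs, ← h ht]
  · intro hst
    exact ⟨(σ.map_adj hst).resolve_left fun he => hst.ne (h he), s, t, hst, rfl, rfl⟩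

/-- Of the equality of images only the inclusion of vertex sets is kept. -/
theorem IsQuasimonophobic.exists_face (hG : IsQuasimonophobic G n) {σ : SingularCube G (n + 1)}
    (hσ : ¬ Function.Injective σ.toFun) {i : Fin (n + 1)} {a : Bool}
    (h : Function.Injective (SingularCube.face i a σ).toFun) :
    ∃ (j : Fin (n + 1)) (b : Bool), (j, b) ≠ (i, a) ∧
      ∀ t, ∃ s, (SingularCube.face j b σ).toFun s = (SingularCube.face i a σ).toFun t := by
  obtain ⟨j, b, hne, he⟩ := (hG _ (isCube_image h)).2 σ hσ i a rfl
  refine ⟨j, b, hne, fun t => ?_⟩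
  have := congrArg SimpleGraph.Subgraph.verts he
  change Set.range _ = Set.range _ at this
  exact this.symm.subset (Set.mem_range_self t)

/-- A triangle x, y, z with distinct vertices gives the noninjective square [xyzz]. Its face xy is
injective, and no other face contains both x and y. -/
theorem IsQuasimonophobic.triangleFree (hG : IsQuasimonophobic G 1) : TriangleFree G := by
  intro x y z hxy hyz hxz
  by_contra! hne
  obtain ⟨h1, h2, h3⟩ := hne
  let σ := square x y z z ⟨hxy, hxz, hyz, Near.refl z⟩
  have hσ : ¬ Function.Injective σ.toFun := fun h => by
    have := @h ![true, false] ![true, true] rfl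
    simp at this
  have hf : Function.Injective (SingularCube.face 0 false σ).toFun := by
    intro s t
    rw [vec_one s, vec_one t]
    cases s 0 <;> cases t 0 <;> simp [SingularCube.face, σ, square, h1, Ne.symm h1]
  obtain ⟨j, b, hne, he⟩ := hG.exists_face hσ hf
  obtain ⟨s, hs⟩ := he ![false]
  obtain ⟨t, ht⟩ := he ![true]
  rw [vec_one s] at hs
  rw [vec_one t] at ht
  fin_cases j <;> cases b <;> cases hs0 : s 0 <;> cases ht0 : t 0 <;>
    simp_all [SingularCube.face, insertNth_two, σ, square]

end Quasimonophobic

/-! ### Symmetries of the square -/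

section Squares

variable {V : Type u} {G : SimpleGraph V}

theorem orientationSign_two (e : Equiv.Perm (Fin 2)) (s : Fin 2 → Bool) :
    orientationSign e s = Equiv.Perm.sign e * (bsign (s 0) * bsign (s 1)) := by
  rw [orientationSign, Fin.prod_univ_two]

theorem perm_two (e : Equiv.Perm (Fin 2)) : e = 1 ∨ e = Equiv.swap 0 1 := by
  decide +revert

theorem SingularCube.toFun_two (σ : SingularCube G 2) (x : Fin 2 → Bool) :
    σ.toFun x = bif x 0 then (bif x 1 then σ.toFun ![true, true] else σ.toFun ![true, false])
      else (bif x 1 then σ.toFun ![false, true] else σ.toFun ![false, false]) := by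
  conv_lhs => rw [vec_two x]
  cases x 0 <;> cases x 1 <;> rfl

/-- A map on the singular `2`-chains which is antisymmetric under the exchange of the coordinates
and under the two reflections is equivariant under all symmetries of the square. -/
theorem map_precomp_two {M : Type*} [AddCommGroup M] (φ : (SingularCube G 2 →₀ ℤ) →ₗ[ℤ] M)
    (h : ∀ a b c d, Near G a b → Near G a c → Near G b d → Near G c d →
      φ (squareChain G a c b d) = - φ (squareChain G a b c d) ∧
      φ (squareChain G c d a b) = - φ (squareChain G a b c d) ∧
      φ (squareChain G b a d c) = - φ (squareChain G a b c d))
    (σ : SingularCube G 2) (e : Equiv.Perm (Fin 2)) (s : Fin 2 → Bool) :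
    φ (Finsupp.single (σ.precomp e s) 1) =
      orientationSign e s • φ (Finsupp.single σ 1) := by
  rw [single_eq_squareChain, single_eq_squareChain σ, orientationSign_two]
  have h1 := σ.near (adj_two false)
  have h2 := σ.near (adj_two' false)
  have h3 := σ.near (adj_two' true)
  have h4 := σ.near (adj_two true)
  have hv : ∀ i j, (σ.precomp e s).toFun ![i, j] = σ.toFun (cubeSymm e s ![i, j]) :=
    fun _ _ => rfl
  simp only [hv, σ.toFun_two (cubeSymm _ _ _)]
  generalize σ.toFun ![false, false] = a at *
  generalize σ.toFun ![false, true] = b at *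
  generalize σ.toFun ![true, false] = c at *
  generalize σ.toFun ![true, true] = d at *
  have h1' := h1.symm
  have h2' := h2.symm
  have h3' := h3.symm
  have h4' := h4.symm
  have k1 := h a b c d h1 h2 h3 h4
  have k2 := h c d a b h4 h2' h3' h1
  have k3 := h b a d c h1' h3 h2 h4'
  have k4 := h d c b a h4' h3' h2' h1'
  rcases perm_two e with rfl | rfl <;> cases hs0 : s 0 <;> cases hs1 : s 1 <;>
    simp [cubeSymm, hs0, hs1, bsign, k1, k2.1, k2.2.2, k3.1, k4.1]

theorem SingularCube.eq_or_eq_of_not_injective {σ : SingularCube G 2}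
    (hn : ¬ Function.Injective σ.toFun) :
    σ.toFun ![false, false] = σ.toFun ![false, true] ∨
    σ.toFun ![false, false] = σ.toFun ![true, false] ∨
    σ.toFun ![false, false] = σ.toFun ![true, true] ∨
    σ.toFun ![false, true] = σ.toFun ![true, false] ∨
    σ.toFun ![false, true] = σ.toFun ![true, true] ∨
    σ.toFun ![true, false] = σ.toFun ![true, true] := by
  contrapose! hn
  obtain ⟨h1, h2, h3, h4, h5, h6⟩ := hn
  intro x y
  rw [vec_two x, vec_two y]
  cases x 0 <;> cases x 1 <;> cases y 0 <;> cases y 1 <;>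
    simp [*, Ne.symm h1, Ne.symm h2, Ne.symm h3, Ne.symm h4, Ne.symm h5, Ne.symm h6]

end Squares

/-! ### Folded squares, and cycles without injective part -/

section Cycles

variable {V : Type u} {G : SimpleGraph V}

variable (G) in
open Classical in
/-- The map which sends an edge to the square folded along it if the edge is increasing for some
auxiliary ordering of the vertices, and to zero otherwise. -/
def foldEdge : (SingularCube G 1 →₀ ℤ) →ₗ[ℤ] ((SingularCube G 2 →₀ ℤ) ⧸ boundaryChains G) :=
  Finsupp.linearCombination ℤ fun τ =>
    if WellOrderingRel (τ.toFun ![false]) (τ.toFun ![true]) then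
      squareClass G (τ.toFun ![false]) (τ.toFun ![false]) (τ.toFun ![true]) (τ.toFun ![false])
    else 0

open Classical in
theorem foldEdge_edgeChain {a b : V} (h : Near G a b) :
    foldEdge G (edgeChain G a b) = if WellOrderingRel a b then squareClass G a a b a else 0 := by
  rw [edgeChain, dif_pos h, foldEdge, Finsupp.linearCombination_single, one_smul]
  simp [edge]

theorem degenerateChains_le_ker_foldEdge :
    degenerateChains G 1 ≤ LinearMap.ker (foldEdge G) := by
  refine Submodule.span_le.2 ?_
  rintro _ ⟨σ, ⟨i, hi⟩, rfl⟩
  have h : σ.toFun ![false] = σ.toFun ![true] := by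
    convert hi ![false] using 2 <;> ext j <;> fin_cases j <;> fin_cases i <;> rfl
  rw [SetLike.mem_coe, LinearMap.mem_ker, foldEdge, Finsupp.linearCombination_single, h,
    if_neg (irrefl _), smul_zero]

variable (G) in
/-- The chains which are determined by their boundary modulo boundaries and degenerate chains. -/
def foldChains : Submodule ℤ (SingularCube G 2 →₀ ℤ) :=
  LinearMap.ker ((boundaryChains G).mkQ - (foldEdge G).comp (singularBoundary G 1))

theorem mem_foldChains {c : SingularCube G 2 →₀ ℤ} :
    c ∈ foldChains G ↔ (boundaryChains G).mkQ c = foldEdge G (singularBoundary G 1 c) := by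
  rw [foldChains, LinearMap.mem_ker, LinearMap.sub_apply, sub_eq_zero, LinearMap.comp_apply]

/-- Both sides of the condition defining `foldChains` vanish: boundaries are cycles, and degenerate
chains have degenerate boundary, which `foldEdge` kills. -/
theorem boundaryChains_le_foldChains : boundaryChains G ≤ foldChains G := by
  have key : ∀ c ∈ boundaryChains G, foldEdge G (singularBoundary G 1 c) = 0 →
      c ∈ foldChains G := fun c hc h => by
    rw [mem_foldChains, h]
    exact (Submodule.Quotient.mk_eq_zero _).2 hc
  refine sup_le ?_ fun c hc => key c (Submodule.mem_sup_right hc)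
    (degenerateChains_le_ker_foldEdge (boundary_degenerate G 1 hc))
  rintro _ ⟨c, rfl⟩
  refine key _ (Submodule.mem_sup_left ⟨c, rfl⟩) ?_
  have := LinearMap.congr_fun (boundary_boundary (SingularCube.face (G := G) (n := 2))
    SingularCube.face SingularCube.face_face) c
  rw [LinearMap.comp_apply, LinearMap.zero_apply] at this
  rw [this, map_zero]

/-- Up to constant edges the boundary is ab + ba. For a ≠ b exactly one of the two directions is
increasing, and by `squareClass_back_comm` it does not matter which. -/
theorem squareChain_fold_mem {a b : V} (h : Near G a b) : squareChain G a a b a ∈ foldChains G := by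
  rw [mem_foldChains, boundary_squareChain (Near.refl a) h (Near.refl a) h.symm]
  have h0 := foldEdge_edgeChain (Near.refl (G := G) a)
  rw [if_neg (irrefl _)] at h0
  rw [map_sub, map_add, map_add, map_neg, h0, foldEdge_edgeChain h, foldEdge_edgeChain h.symm]
  change squareClass G a a b a = _
  rcases trichotomous_of WellOrderingRel a b with hab | rfl | hab
  · simp [hab, asymm hab]
  · simp [squareClass_eq_zero_of_eq]
  · simp [hab, asymm hab, squareClass_back_comm h]

variable (G) in
/-- The class of a singular square modulo `foldChains`. -/
def reducedSquareClass (a b c d : V) : (SingularCube G 2 →₀ ℤ) ⧸ foldChains G :=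
  (foldChains G).mkQ (squareChain G a b c d)

variable (G) in
/-- The projection from chains modulo boundaries to chains modulo `foldChains`. -/
def reduction : ((SingularCube G 2 →₀ ℤ) ⧸ boundaryChains G) →ₗ[ℤ]
    ((SingularCube G 2 →₀ ℤ) ⧸ foldChains G) :=
  (boundaryChains G).liftQ (foldChains G).mkQ
    (by rw [Submodule.ker_mkQ]; exact boundaryChains_le_foldChains)

theorem reduction_squareClass (a b c d : V) :
    reduction G (squareClass G a b c d) = reducedSquareClass G a b c d := rfl

theorem reduction_fold {a b : V} (h : Near G a b) : reduction G (squareClass G a a b a) = 0 :=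
  (Submodule.Quotient.mk_eq_zero _).2 (squareChain_fold_mem h)

variable {a b c d : V}

theorem reducedSquareClass_symm (hab : Near G a b) (hac : Near G a c)
    (hbd : Near G b d) (hcd : Near G c d) :
    reducedSquareClass G a c b d = - reducedSquareClass G a b c d ∧
    reducedSquareClass G c d a b = - reducedSquareClass G a b c d ∧
    reducedSquareClass G b a d c = - reducedSquareClass G a b c d := by
  have h1 := congrArg (reduction G) (squareClass_swap hab hac hbd hcd)
  have h2 := congrArg (reduction G) (squareClass_flip_left hab hac hbd hcd)
  have h3 := congrArg (reduction G) (squareClass_flip_right hab hac hbd hcd)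
  rw [map_add, map_sub, reduction_fold hac, reduction_fold hbd, sub_zero] at h2
  rw [map_add, map_sub, reduction_fold hab, reduction_fold hcd, sub_zero] at h3
  rw [map_neg] at h1
  exact ⟨h1, eq_neg_of_add_eq_zero_right h2, eq_neg_of_add_eq_zero_right h3⟩

theorem reducedSquareClass_fold (hab : Near G a b) (hbd : Near G b d) :
    reducedSquareClass G a b b d = 0 := by
  rw [← reduction_squareClass, squareClass_fold hab hbd, map_zero]

theorem reducedSquareClass_fold' (hab : Near G a b) (hac : Near G a c) :
    reducedSquareClass G a b c a = 0 := by
  rw [← neg_eq_zero, ← (reducedSquareClass_symm hab hac hab.symm hac.symm).2.1]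
  exact reducedSquareClass_fold hac.symm hab

/-- With one edge collapsed the square is a triangle a, c, d, which must have a further coincidence.
-/
theorem reducedSquareClass_edge (hG : TriangleFree G) (hac : Near G a c) (had : Near G a d)
    (hcd : Near G c d) : reducedSquareClass G a a c d = 0 := by
  rcases hG a c d hac hcd had with rfl | rfl | rfl
  · exact reducedSquareClass_fold hac had
  · rw [← reduction_squareClass, squareClass_eq_zero_of_eq, map_zero]
  · exact reduction_fold hac

theorem reducedSquareClass_eq_zero (hG : TriangleFree G) (hab : Near G a b) (hac : Near G a c)
    (hbd : Near G b d) (hcd : Near G c d)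
    (h : a = b ∨ a = c ∨ a = d ∨ b = c ∨ b = d ∨ c = d) : reducedSquareClass G a b c d = 0 := by
  have key := reducedSquareClass_symm hab hac hbd hcd
  rcases h with rfl | rfl | rfl | rfl | rfl | rfl
  · exact reducedSquareClass_edge hG hac hbd hcd
  · rw [← neg_eq_zero, ← key.1]
    exact reducedSquareClass_edge hG hab hcd hbd
  · exact reducedSquareClass_fold' hab hac
  · exact reducedSquareClass_fold hab hbd
  · rw [← neg_eq_zero, ← key.1, ← neg_eq_zero,
      ← (reducedSquareClass_symm hac hab hcd (Near.refl b)).2.1]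
    exact reducedSquareClass_edge hG hab.symm hcd.symm hac
  · rw [← neg_eq_zero, ← key.2.1]
    exact reducedSquareClass_edge hG hac.symm hbd.symm hab

theorem ker_injectivePartAux_le_foldChains (hG : TriangleFree G) :
    LinearMap.ker (injectivePartAux G 2) ≤ foldChains G := by
  refine ker_injectivePartAux_le (fun σ hσ => ?_) (map_precomp_two _ ?_)
  · rw [single_eq_squareChain, ← (foldChains G).ker_mkQ]
    exact reducedSquareClass_eq_zero hG (σ.near (adj_two _)) (σ.near (adj_two' _))
      (σ.near (adj_two' _)) (σ.near (adj_two _)) (SingularCube.eq_or_eq_of_not_injective hσ)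
  · intro a b c d hab hac hbd hcd
    exact reducedSquareClass_symm hab hac hbd hcd

/-- A cycle without injective part is a boundary. -/
theorem mem_boundaryChains_of_injectivePartAux_eq_zero (hG : TriangleFree G)
    {z : SingularCube G 2 →₀ ℤ} (hz : injectivePartAux G 2 z = 0)
    (hz' : singularBoundary G 1 z ∈ degenerateChains G 1) : z ∈ boundaryChains G := by
  -- In `foldChains` the class of `z` is a function of its boundary, which is degenerate.
  rw [← (boundaryChains G).ker_mkQ, LinearMap.mem_ker,
    mem_foldChains.1 (ker_injectivePartAux_le_foldChains hG hz)]
  exact degenerateChains_le_ker_foldEdge hz'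

theorem injectivePartAux_squareChain_of_eq
    (h : a = b ∨ a = c ∨ a = d ∨ b = c ∨ b = d ∨ c = d) :
    injectivePartAux G 2 (squareChain G a b c d) = 0 := by
  rw [squareChain]
  split_ifs with h'
  · refine injectivePartAux_of_not_injective fun hi => ?_
    have hi' := fun x y => @hi x y
    have h1 := hi' ![false, false] ![false, true]
    have h2 := hi' ![false, false] ![true, false]
    have h3 := hi' ![false, false] ![true, true]
    have h4 := hi' ![false, true] ![true, false]
    have h5 := hi' ![false, true] ![true, true]
    have h6 := hi' ![true, false] ![true, true]
    simp [square] at h1 h2 h3 h4 h5 h6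
    tauto
  · exact map_zero _

theorem edgeChain_add_edgeChain_mem (h : Near G a b) :
    edgeChain G b a + edgeChain G a b ∈ degenerateChains G 1 ⊔
      (LinearMap.ker (injectivePartAux G 2)).map (singularBoundary G 1) := by
  -- The coefficient 2 compensates the two constant edges of the folded square.
  have hb : singularBoundary G 1 (squareChain G a a b a) + (2 : ℤ) • edgeChain G a a =
      edgeChain G b a + edgeChain G a b := by
    rw [boundary_squareChain (Near.refl a) h (Near.refl a) h.symm, two_smul]
    abel
  rw [← hb]
  exact Submodule.add_mem _ (Submodule.mem_sup_right ⟨_, injectivePartAux_squareChain_of_eq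
    (Or.inl rfl), rfl⟩) (Submodule.mem_sup_left (Submodule.smul_mem _ _ (edgeChain_self_mem a)))

/-- The only nontrivial symmetry in degree 1 reverses an edge, and the sum of an edge and its
reverse is bounded by a folded square. -/
theorem ker_injectivePartAux_one_le :
    LinearMap.ker (injectivePartAux G 1) ≤ degenerateChains G 1 ⊔
      (LinearMap.ker (injectivePartAux G 2)).map (singularBoundary G 1) := by
  refine ker_injectivePartAux_le (fun σ hσ => Submodule.mem_sup_left ?_) fun σ e s => ?_
  · have h : σ.toFun ![false] = σ.toFun ![true] := by
      contrapose! hσ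
      intro x y
      rw [vec_one x, vec_one y]
      cases x 0 <;> cases y 0 <;> simp [hσ, hσ.symm]
    rw [single_eq_edgeChain, h]
    exact edgeChain_self_mem _
  · obtain rfl : e = 1 := Subsingleton.elim _ _
    have hv : ∀ i, (σ.precomp 1 s).toFun ![i] = σ.toFun ![xor i (s 0)] := fun i =>
      congrArg σ.toFun (vec_one (cubeSymm 1 s ![i]))
    rw [single_eq_edgeChain, single_eq_edgeChain σ, hv, hv]
    cases hs : s 0
    · simp [orientationSign, hs, bsign]
    · rw [← sub_eq_zero]
      simp only [orientationSign, bsign]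
      simp only [Finset.univ_unique, Finset.prod_singleton, Fin.default_eq_zero, hs]
      simp only [Equiv.Perm.sign_one, Units.val_one, one_mul, if_true, neg_smul, one_smul,
        sub_neg_eq_add, ← map_add]
      exact (Submodule.Quotient.mk_eq_zero _).2 (edgeChain_add_edgeChain_mem (σ.near adj_one))

end Cycles

/-! ### Alternating functions of squares in a triangle-free graph -/

section Alternating

variable {V : Type u} {G : SimpleGraph V} {M : Type*} [AddCommGroup M]

/-- Every one of the vertices `p, q, r, s` is among `p', q', r', s'`. -/
def Covers (p' q' r' s' p q r s : V) : Prop :=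
  ∀ x, (x = p ∨ x = q ∨ x = r ∨ x = s) → (x = p' ∨ x = q' ∨ x = r' ∨ x = s')

/-- A function of the vertices of a square which changes its sign under the exchange of the
coordinates and under reflections, and vanishes if two vertices coincide. -/
structure IsAlternating (P : V → V → V → V → M) : Prop where
  swap : ∀ a b c d, P a c b d = - P a b c d
  flip_left : ∀ a b c d, P c d a b = - P a b c d
  flip_right : ∀ a b c d, P b a d c = - P a b c d
  eq_zero : ∀ a b c d, a = b ∨ a = c ∨ a = d ∨ b = c ∨ b = d ∨ c = d → P a b c d = 0

variable {P : V → V → V → V → M}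

theorem IsAlternating.eq_zero_of_near (hP : IsAlternating P) (hG : TriangleFree G) {a b d : V}
    (h : Near G a d) (hab : Near G a b) (hbd : Near G b d) (c : V) : P a b c d = 0 := by
  rcases hG a b d hab hbd h with rfl | rfl | rfl <;> exact hP.eq_zero _ _ _ _ (by simp)

theorem IsAlternating.eq_zero_of_near' (hP : IsAlternating P) (hG : TriangleFree G) {a b c : V}
    (h : Near G b c) (hab : Near G a b) (hac : Near G a c) (d : V) : P a b c d = 0 := by
  rcases hG a b c hab h hac with rfl | rfl | rfl <;> exact hP.eq_zero _ _ _ _ (by simp)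

/-- If a and e are equal or adjacent, each term vanishes for lack of triangles. Otherwise `h` leaves
only a coincidence among the middle vertices x, y, z, and then two terms cancel and the third is
zero. -/
theorem IsAlternating.theta (hP : IsAlternating P) (hG : TriangleFree G) {a e x y z : V}
    (hax : Near G a x) (hay : Near G a y) (haz : Near G a z) (hxe : Near G x e) (hye : Near G y e) (hze : Near G z e)
    (h : a ≠ e → a ≠ x → a ≠ y → a ≠ z → x ≠ e → y ≠ e → z ≠ e → x ≠ y → y ≠ z → x ≠ z → False) :
    P a x y e + P a y z e + P a z x e = 0 := by
  by_cases hae : Near G a e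
  · rw [hP.eq_zero_of_near hG hae hax hxe, hP.eq_zero_of_near hG hae hay hye,
      hP.eq_zero_of_near hG hae haz hze]
    simp
  · have h1 : x = y ∨ y = z ∨ x = z := by
      by_contra! hne
      refine h ?_ ?_ ?_ ?_ ?_ ?_ ?_ hne.1 hne.2.1 hne.2.2 <;> rintro rfl <;>
        first | exact hae ‹_› | exact hae (Near.refl _)
    rcases h1 with rfl | rfl | rfl
    · rw [hP.swap a z x e, hP.eq_zero a x x e (by simp)]
      abel
    · rw [hP.swap a x y e, hP.eq_zero a y y e (by simp)]
      abel
    · rw [hP.swap a y x e, hP.eq_zero a x x e (by simp)]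
      abel

/-- The sum is the boundary of a 3-cube with a at both 000 and 001; `h` is quasimonophobia for the
face cc'dd'. The triangles a, b, b' and a, c, c' have a coincidence each, which makes nine cases.
Only the first and the last need a theta. -/
theorem IsAlternating.sum_eq_zero_of_adj (hP : IsAlternating P) (hG : TriangleFree G)
    {a b b' c c' d d' : V}
    (hab : Near G a b) (hab' : Near G a b') (hac : Near G a c) (hac' : Near G a c')
    (hbb : Near G b b') (hcc : Near G c c') (hdd : Near G d d')
    (hbd : Near G b d) (hbd' : Near G b' d') (hcd : Near G c d) (hcd' : Near G c' d')
    (h : c ≠ c' → c ≠ d → c ≠ d' → c' ≠ d → c' ≠ d' → d ≠ d' →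
      Covers a a b b' c c' d d' ∨ Covers a a c c' c c' d d' ∨ Covers b b' d d' c c' d d' ∨
      Covers a b c d c c' d d' ∨ Covers a b' c' d' c c' d d') :
    - P a a b b' + P c c' d d' + P a a c c' - P b b' d d' - P a b c d + P a b' c' d' = 0 := by
  have e1 : ∀ a b c, P a a b c = 0 := fun a b c => hP.eq_zero _ _ _ _ (by simp)
  have e2 : ∀ a b c, P a b a c = 0 := fun a b c => hP.eq_zero _ _ _ _ (by simp)
  have e5 : ∀ a b c, P a b c b = 0 := fun a b c => hP.eq_zero _ _ _ _ (by simp)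
  simp only [Covers, forall_eq_or_imp, forall_eq] at h
  have s1 := hP.swap
  have s2 := hP.flip_right
  have z1 := fun (x y z : V) => hP.eq_zero_of_near hG (a := x) (b := y) (d := z)
  have z2 := fun (x y z : V) => hP.eq_zero_of_near' hG (a := x) (b := y) (c := z)
  rcases hG a b b' hab hbb hab' with rfl | rfl | rfl <;>
    rcases hG a c c' hac hcc hac' with rfl | rfl | rfl <;> simp only [e1, e2, neg_zero, add_zero,
      zero_add, sub_zero, zero_sub]
  -- Case a = b = c: a theta from a to d' through c', d, b'.
  · have := hP.theta hG hac' hbd hab' hcd' hdd hbd' (fun h1 h2 h3 h4 h5 h6 h7 h8 h9 h10 => by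
      simp [*, h1.symm, h2.symm, h3.symm, h5.symm, h6.symm, h7.symm, h8.symm] at h)
    rw [s1 a d b' d']
    refine Eq.trans ?_ this
    abel
  · rcases hG a c d hac hcd hbd with rfl | rfl | rfl
    · rw [e2, z1 a b' d' hcd' hab' hbd']
      abel
    · abel
    · rw [e2, z1 a b' d' hdd hab' hbd']
      abel
  · rw [z2 c a d hbd hac.symm hcd, z1 a b' d' hcd' hab' hbd']
    abel
  · rcases hG a b d hab hbd hcd with h' | h' | h'
    · subst h'
      rw [e1, z1 a c' d' hbd' hac' hcd']
      abel
    · subst h'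
      rw [s1 a b c' d']
      abel
    · subst h'
      rw [e2, z1 a b d' hdd hab hbd']
      abel
  · rcases hG b d d' hbd hdd hbd' with h' | h' | h'
    · subst h'
      rw [e5, z2 a b c hcd.symm hab hac]
      abel
    · subst h'
      abel
    · subst h'
      rw [e5, z2 a b c hcd'.symm hab hac]
      abel
  · rcases hG a b d' hab hbd' hcd' with h' | h' | h'
    · subst h'
      rw [e1, z2 c a d hbd hac.symm hcd]
      abel
    · subst h'
      rw [s2 a c b d, s1 a b c d]
      abel
    · subst h'
      rw [z2 c a d hdd.symm hac.symm hcd, z1 a b d hdd.symm hab hbd]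
      abel
  · rw [z1 a c' d' hbd' hac' hcd', z2 b a d hcd hab.symm hbd]
    abel
  · rcases hG a c d' hac hcd' hbd' with h' | h' | h'
    · subst h'
      rw [e2, z2 b a d hcd hab.symm hbd]
      abel
    · subst h'
      rw [s2 a b c d]
      abel
    · subst h'
      rw [z2 b a d hdd.symm hab.symm hbd, z1 a b d hdd.symm hab hbd]
      abel
  -- Case a = b' = c': a theta from a to d through b, c, d'.
  · have := hP.theta hG hab hac hbd' hbd hcd hdd.symm (fun h1 h2 h3 h4 h5 h6 h7 h8 h9 h10 => by
      simp [*, h1.symm, h3.symm, h4.symm, h5.symm, h6.symm, h7.symm, h8.symm, h9.symm,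
        h10.symm] at h)
    rw [s2 a c d' d, s2 a b d' d, s1 a d' b d]
    refine Eq.trans ?_ (neg_eq_zero.2 this)
    abel

/-- The sum is the boundary of a 3-cube with a at both 000 and 011 and no collapsed edge. The
hypotheses `h1`, `h2`, `h3` are quasimonophobia for the faces defg, abde, acdf. -/
theorem IsAlternating.sum_eq_zero_of_diag (hP : IsAlternating P) (hG : TriangleFree G)
    {a b c d e f g : V}
    (hab : Near G a b) (hac : Near G a c) (had : Near G a d) (hag : Near G a g)
    (hbe : Near G b e) (hcf : Near G c f) (hde : Near G d e) (hdf : Near G d f)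
    (heg : Near G e g) (hfg : Near G f g)
    (n1 : a ≠ b) (n2 : a ≠ c) (n3 : a ≠ d) (n4 : a ≠ g) (n5 : b ≠ e)
    (n6 : c ≠ f) (n7 : d ≠ e) (n8 : d ≠ f) (n9 : e ≠ g) (n10 : f ≠ g)
    (h1 : d ≠ e → d ≠ f → d ≠ g → e ≠ f → e ≠ g → f ≠ g →
      Covers a b c a d e f g ∨ Covers a b d e d e f g ∨ Covers c a f g d e f g ∨
      Covers a c d f d e f g ∨ Covers b a e g d e f g)
    (h2 : a ≠ b → a ≠ d → a ≠ e → b ≠ d → b ≠ e → d ≠ e →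
      Covers a b c a a b d e ∨ Covers d e f g a b d e ∨ Covers c a f g a b d e ∨
      Covers a c d f a b d e ∨ Covers b a e g a b d e)
    (h3 : a ≠ c → a ≠ d → a ≠ f → c ≠ d → c ≠ f → d ≠ f →
      Covers a b c a a c d f ∨ Covers d e f g a c d f ∨ Covers a b d e a c d f ∨
      Covers c a f g a c d f ∨ Covers b a e g a c d f) :
    - P a b c a + P d e f g + P a b d e - P c a f g - P a c d f + P b a e g = 0 := by
  simp only [Covers, forall_eq_or_imp, forall_eq] at h1 h2 h3
  rw [hP.eq_zero a b c a (by simp)]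
  rcases eq_or_ne d g with rfl | hdg
  · rw [hP.eq_zero d e f d (by simp), hP.flip_right a c d f, hP.flip_right a b d e]
    abel
  rcases eq_or_ne e f with rfl | hef
  -- For e = f the remaining squares join a to e, and their middle vertices run through the closed
  -- walk b, d, c, g. A coincidence among these gives a cancellation or a theta; if they are
  -- distinct and a ≠ e, no other face covers abde, against `h2`.
  · rw [hP.eq_zero d e e g (by simp), hP.flip_right a c g e, hP.flip_right a b g e]
    rcases eq_or_ne a e with rfl | hae
    · simp [hP.eq_zero]
    rcases eq_or_ne b c with rfl | hbc
    · abel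
    rcases eq_or_ne b d with rfl | hbd
    · have := hP.theta hG hac hag hab hcf heg.symm hbe (by grind)
      rw [hP.eq_zero a b b e (by simp), hP.swap a g b e, hP.swap a b c e]
      refine Eq.trans ?_ this
      abel
    rcases eq_or_ne c d with rfl | hcd
    · have := hP.theta hG hac hag hab hcf heg.symm hbe (by grind)
      rw [hP.eq_zero a c c e (by simp), hP.swap a g b e]
      refine Eq.trans ?_ this
      abel
    rcases eq_or_ne b g with rfl | hbg
    · have := hP.theta hG hab had hac hbe hde hcf (by grind)
      rw [hP.eq_zero a b b e (by simp), hP.swap a d c e]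
      refine Eq.trans ?_ this
      abel
    rcases eq_or_ne c g with rfl | hcg
    · have := hP.theta hG hab had hac hbe hde hcf (by grind)
      rw [hP.eq_zero a c c e (by simp), hP.swap a d c e, hP.swap a c b e]
      refine Eq.trans ?_ this
      abel
    grind
  -- Now defg is injective, so another face contains its four vertices. As a differs from d and g,
  -- this forces a to be e or f.
  · have hae : a = e ∨ a = f := by
      by_contra! hne
      grind
    rcases hae with rfl | rfl
    · have := hP.theta hG had hag hac hdf hfg.symm hcf (by grind)
      rw [hP.flip_right a d g f, hP.flip_right a c g f, hP.eq_zero a b d a (by simp),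
        hP.eq_zero b a a g (by simp)]
      rw [hP.swap a c g f] at this
      refine Eq.trans ?_ (neg_eq_zero.2 this)
      abel
    · have := hP.theta hG hab had hag hbe hde heg.symm (by grind)
      rw [hP.flip_left a g d e, hP.swap a d g e, hP.flip_right a b g e,
        hP.eq_zero c a a g (by simp), hP.eq_zero a c d a (by simp)]
      rw [hP.swap a b g e] at this
      refine Eq.trans ?_ this
      abel

end Alternating

/-! ### Compatibility of the injective part with the boundary in low degrees -/

section ChainMap

variable {V : Type u} {G : SimpleGraph V} {n : ℕ}

theorem injectivePartAux_boundary_of_injective {σ : SingularCube G (n + 1)}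
    (h : Function.Injective σ.toFun) :
    injectivePartAux G n (singularBoundary G n (Finsupp.single σ 1)) =
      cellularBoundary G n (injectivePartAux G (n + 1) (Finsupp.single σ 1)) := by
  rw [injectivePartAux_of_injective h, cellularBoundary, Submodule.mkQ_apply, Submodule.mapQ_apply,
    boundary_single', boundary_single', map_sum, ← Submodule.mkQ_apply, map_sum]
  refine Finset.sum_congr rfl fun i _ => ?_
  rw [map_sum, map_sum]
  refine Finset.sum_congr rfl fun a _ => ?_
  rw [map_smul, map_smul]
  exact congrArg _ (injectivePartAux_of_injective (CubeChart.face i a ⟨σ, h⟩).2)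

/-- To keep only the injective part is compatible with the boundary if the boundaries of the
noninjective cubes have no injective part. -/
theorem injectivePartAux_boundary
    (h : ∀ σ : SingularCube G (n + 1), ¬ Function.Injective σ.toFun →
      injectivePartAux G n (singularBoundary G n (Finsupp.single σ 1)) = 0)
    (c : SingularCube G (n + 1) →₀ ℤ) :
    injectivePartAux G n (singularBoundary G n c) =
      cellularBoundary G n (injectivePartAux G (n + 1) c) := by
  have : (injectivePartAux G n).comp (singularBoundary G n) =
      (cellularBoundary G n).comp (injectivePartAux G (n + 1)) := by
    refine Finsupp.lhom_ext' fun σ => LinearMap.ext_ring ?_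
    change injectivePartAux G n (singularBoundary G n (Finsupp.single σ 1)) =
      cellularBoundary G n (injectivePartAux G (n + 1) (Finsupp.single σ 1))
    by_cases hσ : Function.Injective σ.toFun
    · exact injectivePartAux_boundary_of_injective hσ
    · rw [h σ hσ, injectivePartAux_of_not_injective hσ, map_zero]
  exact LinearMap.congr_fun this c

theorem SingularCube.face_precomp (σ : SingularCube G (n + 1)) (e : Equiv.Perm (Fin (n + 1)))
    (s : Fin (n + 1) → Bool) (k : Fin (n + 1)) (e' : Equiv.Perm (Fin n))
    (h : ∀ j, e (k.succAbove j) = (e k).succAbove (e' j)) (a : Bool) :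
    SingularCube.face (e k) a (σ.precomp e s) =
      (SingularCube.face k (xor a (s k)) σ).precomp e' (fun j => s (k.succAbove j)) := by
  refine GraphMap.ext (funext fun t => ?_)
  change σ.toFun _ = σ.toFun _
  congr 1
  symm
  rw [Fin.insertNth_eq_iff]
  refine ⟨by simp [cubeSymm], funext fun j => ?_⟩
  simp [Fin.removeNth, cubeSymm, h]

/-- This permits moving a noninjective cube into a normal position. Each face of the reparametrized
cube is a reparametrized face, and the orientation signs match as in a cofactor expansion. -/
theorem injectivePartAux_boundary_precomp (σ : SingularCube G (n + 1))
    (e : Equiv.Perm (Fin (n + 1))) (s : Fin (n + 1) → Bool) :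
    injectivePartAux G n (singularBoundary G n (Finsupp.single (σ.precomp e s) 1)) =
      orientationSign e s •
        injectivePartAux G n (singularBoundary G n (Finsupp.single σ 1)) := by
  rw [boundary_single', boundary_single', ← Equiv.sum_comp e]
  simp only [map_sum, map_smul, Finset.smul_sum, smul_smul]
  refine Finset.sum_congr rfl fun k _ => ?_
  obtain ⟨e', he', hsign⟩ := exists_restrict_perm e k
  have hb : ∀ a b, bsign (xor a b) = bsign a * bsign b := by decide
  have hbb : ∀ b, bsign b * bsign b = 1 := by decide
  let E : Equiv.Perm Bool := ⟨fun a => xor a (s k), fun a => xor a (s k), fun a => by simp,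
    fun a => by simp⟩
  rw [← Equiv.sum_comp E (fun a : Bool => (orientationSign e s *
    ((-1 : ℤ) ^ ((k : ℕ) + 1) * bsign a)) •
      injectivePartAux G n (Finsupp.single (SingularCube.face k a σ) (1 : ℤ)))]
  refine Finset.sum_congr rfl fun a _ => ?_
  rw [SingularCube.face_precomp σ e s k e' he', injectivePartAux_precomp, smul_smul]
  congr 1
  simp only [orientationSign, hsign, Fin.prod_univ_succAbove _ k]
  change _ = _ * ((-1 : ℤ) ^ ((k : ℕ) + 1) * bsign (xor a (s k)))
  rw [hb]
  have h2 : ((-1 : ℤ) ^ (k : ℕ)) * (-1) ^ (k : ℕ) = 1 := by rw [← mul_pow]; simp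
  simp only [pow_add, pow_one]
  linear_combination ((-1 : ℤ) ^ (e k : ℕ) * (Equiv.Perm.sign e' : ℤ) *
    (∏ j, bsign (s (k.succAbove j))) * bsign a) *
      ((bsign (s k) * bsign (s k)) * h2 + hbb (s k))

theorem injectivePartAux_edgeChain_self (a : V) :
    injectivePartAux G 1 (edgeChain G a a) = 0 :=
  degenerateChains_le_ker G 1 (edgeChain_self_mem a)

theorem injectivePartAux_edgeChain_symm {a b : V} (h : Near G a b) :
    injectivePartAux G 1 (edgeChain G b a) = - injectivePartAux G 1 (edgeChain G a b) := by
  have := injectivePartAux_precomp (edge a b h) 1 fun _ => true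
  rw [single_eq_edgeChain, single_eq_edgeChain] at this
  simpa [orientationSign, bsign, SingularCube.precomp, cubeSymm, edge] using this

theorem injectivePartAux_boundary_two (hG : TriangleFree G) {σ : SingularCube G 2}
    (hσ : ¬ Function.Injective σ.toFun) :
    injectivePartAux G 1 (singularBoundary G 1 (Finsupp.single σ 1)) = 0 := by
  rw [boundary_two]
  simp only [map_add, map_sub, map_neg]
  have h := SingularCube.eq_or_eq_of_not_injective hσ
  have h1 := σ.near (adj_two false)
  have h2 := σ.near (adj_two' false)
  have h3 := σ.near (adj_two' true)
  have h4 := σ.near (adj_two true)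
  generalize σ.toFun ![false, false] = a at *
  generalize σ.toFun ![false, true] = b at *
  generalize σ.toFun ![true, false] = c at *
  generalize σ.toFun ![true, true] = d at *
  -- Since triangles are degenerate, oriented edges add up along them; collapsing an edge of the
  -- square leaves such a triangle.
  have key : ∀ x y z, Near G x y → Near G y z → Near G x z →
      injectivePartAux G 1 (edgeChain G x y) + injectivePartAux G 1 (edgeChain G y z) =
        injectivePartAux G 1 (edgeChain G x z) := by
    intro x y z hxy hyz hxz
    rcases hG x y z hxy hyz hxz with rfl | rfl | rfl
    · simp [injectivePartAux_edgeChain_self]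
    · simp [injectivePartAux_edgeChain_self]
    · simp [injectivePartAux_edgeChain_self, injectivePartAux_edgeChain_symm hxy]
  rcases h with rfl | rfl | rfl | rfl | rfl | rfl
  · rw [← key a c d h2 h4 h3, injectivePartAux_edgeChain_self]
    abel
  · rw [← key a b d h1 h3 h4, injectivePartAux_edgeChain_self]
    abel
  · rw [injectivePartAux_edgeChain_symm h1, injectivePartAux_edgeChain_symm h2]
    abel
  · abel
  · rw [← key a c b h2 h4 h1, injectivePartAux_edgeChain_self]
    abel
  · rw [← key a b c h1 h3 h2, injectivePartAux_edgeChain_self]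
    abel

/-- The identities need no adjacency assumption: the symmetries permute the four conditions under
which `squareChain` is nonzero, so both sides vanish together when these fail. -/
theorem isAlternating_injectivePartAux :
    IsAlternating fun a b c d : V => injectivePartAux G 2 (squareChain G a b c d) := by
  have key : ∀ a b c d a' b' c' d' (e : Equiv.Perm (Fin 2)) (s : Fin 2 → Bool),
      orientationSign e s = -1 →
      ((Near G a b ∧ Near G a c ∧ Near G b d ∧ Near G c d) ↔
        (Near G a' b' ∧ Near G a' c' ∧ Near G b' d' ∧ Near G c' d')) →
      (∀ h h', (square (G := G) a b c d h).precomp e s = square a' b' c' d' h') →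
      injectivePartAux G 2 (squareChain G a' b' c' d') =
        - injectivePartAux G 2 (squareChain G a b c d) := by
    intro a b c d a' b' c' d' e s hs hiff hp
    by_cases h : Near G a b ∧ Near G a c ∧ Near G b d ∧ Near G c d
    · rw [squareChain, squareChain, dif_pos h, dif_pos (hiff.1 h), ← hp h (hiff.1 h),
        injectivePartAux_precomp, hs, neg_one_zsmul]
    · rw [squareChain, squareChain, dif_neg h, dif_neg (mt hiff.2 h), map_zero, neg_zero]
  refine ⟨fun a b c d => ?_, fun a b c d => ?_, fun a b c d => ?_,
    fun a b c d h => injectivePartAux_squareChain_of_eq h⟩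
  · refine key a b c d a c b d (Equiv.swap 0 1) (fun _ => false) (by decide) (by tauto)
      fun h h' => GraphMap.ext (funext fun x => ?_)
    simp only [SingularCube.precomp, square, cubeSymm]
    cases h0 : x 0 <;> cases h1 : x 1 <;> simp [h0, h1]
  · refine key a b c d c d a b 1 ![true, false] (by decide)
      (by rw [near_comm (x := c) (y := a), near_comm (x := d) (y := b)]; tauto)
      fun h h' => GraphMap.ext (funext fun x => ?_)
    simp only [SingularCube.precomp, square, cubeSymm]
    cases h0 : x 0 <;> cases h1 : x 1 <;> simp [h0, h1]
  · refine key a b c d b a d c 1 ![false, true] (by decide)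
      (by rw [near_comm (x := b) (y := a), near_comm (x := d) (y := c)]; tauto)
      fun h h' => GraphMap.ext (funext fun x => ?_)
    simp only [SingularCube.precomp, square, cubeSymm]
    cases h0 : x 0 <;> cases h1 : x 1 <;> simp [h0, h1]

theorem adj_three (i j : Bool) : (cubeGraph 3).Adj ![false, i, j] ![true, i, j] ∧
    (cubeGraph 3).Adj ![i, false, j] ![i, true, j] ∧
    (cubeGraph 3).Adj ![i, j, false] ![i, j, true] :=
  ⟨⟨0, by decide +revert, by decide +revert⟩, ⟨1, by decide +revert, by decide +revert⟩,
    ⟨2, by decide +revert, by decide +revert⟩⟩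

theorem covers_of_forall_exists {τ τ' : SingularCube G 2}
    (h : ∀ t, ∃ s, τ'.toFun s = τ.toFun t) :
    Covers (τ'.toFun ![false, false]) (τ'.toFun ![false, true]) (τ'.toFun ![true, false])
      (τ'.toFun ![true, true]) (τ.toFun ![false, false]) (τ.toFun ![false, true])
      (τ.toFun ![true, false]) (τ.toFun ![true, true]) := by
  have key : ∀ t, τ.toFun t = τ'.toFun ![false, false] ∨ τ.toFun t = τ'.toFun ![false, true] ∨
      τ.toFun t = τ'.toFun ![true, false] ∨ τ.toFun t = τ'.toFun ![true, true] := by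
    intro t
    obtain ⟨s, hs⟩ := h t
    rw [← hs, vec_two s]
    cases s 0 <;> cases s 1 <;> simp
  rintro x (rfl | rfl | rfl | rfl) <;> exact key _

theorem IsQuasimonophobic.exists_covers (hG : IsQuasimonophobic G 2) {σ : SingularCube G 3}
    (hσ : ¬ Function.Injective σ.toFun) (i : Fin 3) (a : Bool) {τ : SingularCube G 2}
    (hτ : SingularCube.face i a σ = τ)
    (h1 : τ.toFun ![false, false] ≠ τ.toFun ![false, true])
    (h2 : τ.toFun ![false, false] ≠ τ.toFun ![true, false])
    (h3 : τ.toFun ![false, false] ≠ τ.toFun ![true, true])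
    (h4 : τ.toFun ![false, true] ≠ τ.toFun ![true, false])
    (h5 : τ.toFun ![false, true] ≠ τ.toFun ![true, true])
    (h6 : τ.toFun ![true, false] ≠ τ.toFun ![true, true]) :
    ∃ (j : Fin 3) (b : Bool), (j, b) ≠ (i, a) ∧
      Covers ((SingularCube.face j b σ).toFun ![false, false])
        ((SingularCube.face j b σ).toFun ![false, true])
        ((SingularCube.face j b σ).toFun ![true, false])
        ((SingularCube.face j b σ).toFun ![true, true]) (τ.toFun ![false, false])
        (τ.toFun ![false, true]) (τ.toFun ![true, false]) (τ.toFun ![true, true]) := by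
  subst hτ
  have hi : Function.Injective (SingularCube.face i a σ).toFun := by
    by_contra hn
    have := SingularCube.eq_or_eq_of_not_injective hn
    tauto
  obtain ⟨j, b, hne, h⟩ := hG.exists_face hσ hi
  exact ⟨j, b, hne, covers_of_forall_exists h⟩

theorem injectivePartAux_boundary_three_of_adj (h₁ : TriangleFree G) (h₂ : IsQuasimonophobic G 2)
    {σ : SingularCube G 3}
    (h : σ.toFun ![false, false, false] = σ.toFun ![false, false, true]) :
    injectivePartAux G 2 (singularBoundary G 2 (Finsupp.single σ 1)) = 0 := by
  have hσ : ¬ Function.Injective σ.toFun := fun hi => by simpa using hi h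
  have hn : ∀ i j, Near G (σ.toFun ![false, i, j]) (σ.toFun ![true, i, j]) ∧
      Near G (σ.toFun ![i, false, j]) (σ.toFun ![i, true, j]) ∧
      Near G (σ.toFun ![i, j, false]) (σ.toFun ![i, j, true]) := fun i j =>
    ⟨σ.near (adj_three i j).1, σ.near (adj_three i j).2.1, σ.near (adj_three i j).2.2⟩
  rw [boundary_three, ← h]
  simp only [map_add, map_sub, map_neg]
  refine isAlternating_injectivePartAux.sum_eq_zero_of_adj h₁ (hn false false).2.1
    (h ▸ (hn false true).2.1) (hn false false).1 (h ▸ (hn false true).1) (hn false true).2.2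
    (hn true false).2.2 (hn true true).2.2 (hn true false).1 (hn true true).1 (hn true false).2.1
    (hn true true).2.1 fun h1 h2 h3 h4 h5 h6 => ?_
  have hc := h₂.exists_covers hσ 0 true rfl
  simp only [SingularCube.face, insertNth_three] at hc
  obtain ⟨j, b, hne, hc⟩ := hc h1 h2 h3 h4 h5 h6
  fin_cases j <;> cases b <;> simp_all [insertNth_three]

theorem injectivePartAux_boundary_three_of_diag (h₁ : TriangleFree G) (h₂ : IsQuasimonophobic G 2)
    {σ : SingularCube G 3}
    (hadj : ∀ s t, (cubeGraph 3).Adj s t → σ.toFun s ≠ σ.toFun t)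
    (h : σ.toFun ![false, false, false] = σ.toFun ![false, true, true]) :
    injectivePartAux G 2 (singularBoundary G 2 (Finsupp.single σ 1)) = 0 := by
  have hσ : ¬ Function.Injective σ.toFun := fun hi => by simpa using hi h
  have hn : ∀ i j, Near G (σ.toFun ![false, i, j]) (σ.toFun ![true, i, j]) ∧
      Near G (σ.toFun ![i, false, j]) (σ.toFun ![i, true, j]) ∧
      Near G (σ.toFun ![i, j, false]) (σ.toFun ![i, j, true]) := fun i j =>
    ⟨σ.near (adj_three i j).1, σ.near (adj_three i j).2.1, σ.near (adj_three i j).2.2⟩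
  have hd : ∀ i j, σ.toFun ![false, i, j] ≠ σ.toFun ![true, i, j] ∧
      σ.toFun ![i, false, j] ≠ σ.toFun ![i, true, j] ∧
      σ.toFun ![i, j, false] ≠ σ.toFun ![i, j, true] := fun i j =>
    ⟨hadj _ _ (adj_three i j).1, hadj _ _ (adj_three i j).2.1, hadj _ _ (adj_three i j).2.2⟩
  rw [boundary_three, ← h]
  simp only [map_add, map_sub, map_neg]
  refine isAlternating_injectivePartAux.sum_eq_zero_of_diag h₁ (hn false false).2.2
    (hn false false).2.1 (hn false false).1 (h ▸ (hn true true).1) (hn false true).1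
    (hn true false).1 (hn true false).2.2 (hn true false).2.1 (hn true true).2.1 (hn true true).2.2
    (hd false false).2.2 (hd false false).2.1 (hd false false).1 (h ▸ (hd true true).1)
    (hd false true).1 (hd true false).1 (hd true false).2.2 (hd true false).2.1 (hd true true).2.1
    (hd true true).2.2 (fun h1 h2 h3 h4 h5 h6 => ?_) (fun h1 h2 h3 h4 h5 h6 => ?_)
    (fun h1 h2 h3 h4 h5 h6 => ?_)
  · have hc := h₂.exists_covers hσ 0 true rfl
    simp only [SingularCube.face, insertNth_three] at hc
    obtain ⟨j, b, hne, hc⟩ := hc h1 h2 h3 h4 h5 h6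
    fin_cases j <;> cases b <;> simp_all [insertNth_three]
  · have hc := h₂.exists_covers hσ 1 false rfl
    simp only [SingularCube.face, insertNth_three] at hc
    obtain ⟨j, b, hne, hc⟩ := hc h1 h2 h3 h4 h5 h6
    fin_cases j <;> cases b <;> simp_all [insertNth_three]
  · have hc := h₂.exists_covers hσ 2 false rfl
    simp only [SingularCube.face, insertNth_three] at hc
    obtain ⟨j, b, hne, hc⟩ := hc h1 h2 h3 h4 h5 h6
    fin_cases j <;> cases b <;> simp_all [insertNth_three]

/-- Reflecting by `s` moves 000 to `s`; a permutation then arranges the coordinates in which `t`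
differs. The three alternatives are the distances 1, 2, 3. -/
theorem exists_cubeSymm_of_ne (s t : Fin 3 → Bool) (h : s ≠ t) : ∃ e : Equiv.Perm (Fin 3),
    cubeSymm e s ![false, false, false] = s ∧ (cubeSymm e s ![false, false, true] = t ∨
      cubeSymm e s ![false, true, true] = t ∨ cubeSymm e s ![true, true, true] = t) := by
  decide +revert

theorem cubeSymm_of_adj {s t : Fin 3 → Bool} (h : (cubeGraph 3).Adj s t) :
    ∃ e : Equiv.Perm (Fin 3), cubeSymm e s ![false, false, false] = s ∧
      cubeSymm e s ![false, false, true] = t := by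
  obtain ⟨k, hk, hu⟩ := h
  have ht : t = Function.update s k (!s k) := by
    funext j
    by_cases hj : j = k
    · subst hj
      rw [Function.update_self]
      revert hk
      cases s j <;> cases t j <;> simp
    · rw [Function.update_of_ne hj]
      exact (by_contra fun hne => hj (hu j (Ne.symm hne)))
  rw [ht]
  clear hk hu ht
  refine ⟨Equiv.swap k 2, ?_⟩
  decide +revert

theorem injectivePartAux_boundary_eq_zero_of_precomp {σ : SingularCube G (n + 1)}
    (e : Equiv.Perm (Fin (n + 1))) (s : Fin (n + 1) → Bool)
    (h : injectivePartAux G n (singularBoundary G n (Finsupp.single (σ.precomp e s) 1)) = 0) :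
    injectivePartAux G n (singularBoundary G n (Finsupp.single σ 1)) = 0 := by
  rw [injectivePartAux_boundary_precomp] at h
  have hs : orientationSign e s * orientationSign e s = 1 := by
    have hb : ∀ b, bsign b * bsign b = 1 := by decide
    rw [orientationSign, mul_mul_mul_comm, ← Finset.prod_mul_distrib]
    simp only [hb, Finset.prod_const_one, mul_one]
    rw [← Units.val_mul, Int.units_mul_self, Units.val_one]
  have := congrArg (orientationSign e s • ·) h
  simpa only [smul_smul, hs, one_smul, smul_zero] using this

theorem injectivePartAux_boundary_three (h₁ : TriangleFree G) (h₂ : IsQuasimonophobic G 2)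
    {σ : SingularCube G 3} (hσ : ¬ Function.Injective σ.toFun) :
    injectivePartAux G 2 (singularBoundary G 2 (Finsupp.single σ 1)) = 0 := by
  by_cases hadj : ∀ s t, (cubeGraph 3).Adj s t → σ.toFun s ≠ σ.toFun t
  · simp only [Function.Injective, not_forall] at hσ
    obtain ⟨s, t, h, hst⟩ := hσ
    obtain ⟨e, hs, ht⟩ := exists_cubeSymm_of_ne s t hst
    refine injectivePartAux_boundary_eq_zero_of_precomp e s ?_
    have hadj' : ∀ x y, (cubeGraph 3).Adj x y →
        (σ.precomp e s).toFun x ≠ (σ.precomp e s).toFun y :=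
      fun x y hxy => hadj _ _ (cubeGraph_adj_cubeSymm e s hxy)
    have hs' : (σ.precomp e s).toFun ![false, false, false] = σ.toFun t := by
      rw [← h]
      exact congrArg σ.toFun hs
    rcases ht with ht | ht | ht <;> replace ht := hs'.trans (congrArg σ.toFun ht).symm
    · exact absurd ht (hadj' _ _ (adj_three _ _).2.2)
    · exact injectivePartAux_boundary_three_of_diag h₁ h₂ hadj' ht
    -- Antipodal vertices: the path 000, 001, 011, 111 closes up to a triangle, so one of its edges
    -- is collapsed.
    · have k1 := adj_three false false
      have k2 := adj_three false true
      have k3 := adj_three true true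
      change _ = (σ.precomp e s).toFun ![true, true, true] at ht
      rcases h₁ _ _ _ ((σ.precomp e s).near k1.2.2) ((σ.precomp e s).near k2.2.1)
        (ht ▸ ((σ.precomp e s).near k3.1).symm) with h' | h' | h'
      · exact absurd h' (hadj' _ _ k1.2.2)
      · exact absurd h' (hadj' _ _ k2.2.1)
      · exact absurd (h'.symm.trans ht) (hadj' _ _ k3.1)
  · push Not at hadj
    obtain ⟨s, t, hst, h⟩ := hadj
    obtain ⟨e, hs, ht⟩ := cubeSymm_of_adj hst
    refine injectivePartAux_boundary_eq_zero_of_precomp e s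
      (injectivePartAux_boundary_three_of_adj h₁ h₂ ?_)
    change σ.toFun (cubeSymm _ _ _) = σ.toFun (cubeSymm _ _ _)
    rw [hs, ht, h]

end ChainMap

/-! ### An elementwise criterion for isomorphisms on homology -/

section ShortComplex

variable {R : Type*} [Ring R]

theorem homologyπ_eq_zero_iff (S : ShortComplex (ModuleCat.{u} R)) (z : S.cycles) :
    S.homologyπ z = 0 ↔ ∃ w, S.f w = S.iCycles z := by
  have h : S.homologyι (S.homologyπ z) = S.pOpcycles (S.iCycles z) := by
    rw [← ConcreteCategory.comp_apply, ← ConcreteCategory.comp_apply, S.homology_π_ι]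
  have hι : Function.Injective S.homologyι :=
    (ModuleCat.mono_iff_injective S.homologyι).1 inferInstance
  rw [← map_eq_zero_iff S.homologyι.hom hι]
  exact h ▸ S.moduleCat_pOpcycles_eq_zero_iff _

theorem exists_iCycles_eq (S : ShortComplex (ModuleCat.{u} R)) (x : S.X₂) (hx : S.g x = 0) :
    ∃ z, S.iCycles z = x := by
  refine ⟨S.moduleCatCyclesIso.inv ⟨x, hx⟩, ?_⟩
  exact S.moduleCatCyclesIso_inv_iCycles_apply _

theorem isIso_homologyMap_of_forall {S₁ S₂ : ShortComplex (ModuleCat.{u} R)} (ψ : S₁ ⟶ S₂)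
    (hinj : ∀ (x : S₁.X₂) (w : S₂.X₁), S₁.g x = 0 → S₂.f w = ψ.τ₂ x → ∃ v, S₁.f v = x)
    (hsurj : ∀ y : S₂.X₂, S₂.g y = 0 → ∃ x, S₁.g x = 0 ∧ ψ.τ₂ x = y) :
    IsIso (ShortComplex.homologyMap ψ) := by
  have hπ : ∀ z, ShortComplex.homologyMap ψ (S₁.homologyπ z) =
      S₂.homologyπ (ShortComplex.cyclesMap ψ z) := fun z => by
    rw [← ConcreteCategory.comp_apply, ← ConcreteCategory.comp_apply,
      ShortComplex.homologyπ_naturality]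
  have hi : ∀ z, S₂.iCycles (ShortComplex.cyclesMap ψ z) = ψ.τ₂ (S₁.iCycles z) := fun z => by
    rw [← ConcreteCategory.comp_apply, ← ConcreteCategory.comp_apply, ShortComplex.cyclesMap_i]
  have hs : ∀ S : ShortComplex (ModuleCat.{u} R), Function.Surjective S.homologyπ := fun S =>
    (ModuleCat.epi_iff_surjective S.homologyπ).1 inferInstance
  have hg : ∀ (S : ShortComplex (ModuleCat.{u} R)) z, S.g (S.iCycles z) = 0 := fun S z => by
    rw [← ConcreteCategory.comp_apply, S.iCycles_g]
    rfl
  rw [ConcreteCategory.isIso_iff_bijective]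
  constructor
  · rw [← ModuleCat.mono_iff_injective, ModuleCat.mono_iff_ker_eq_bot, LinearMap.ker_eq_bot']
    intro x hx
    obtain ⟨z, rfl⟩ := hs S₁ x
    change ShortComplex.homologyMap ψ (S₁.homologyπ z) = 0 at hx
    rw [hπ, homologyπ_eq_zero_iff] at hx
    obtain ⟨w, hw⟩ := hx
    rw [hi] at hw
    exact (homologyπ_eq_zero_iff _ _).2 (hinj _ w (hg _ z) hw)
  · intro y
    obtain ⟨z, rfl⟩ := hs S₂ y
    obtain ⟨x, hx, hxy⟩ := hsurj _ (hg _ z)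
    obtain ⟨z', rfl⟩ := exists_iCycles_eq S₁ x hx
    refine ⟨S₁.homologyπ z', ?_⟩
    rw [hπ]
    congr 1
    apply (ModuleCat.mono_iff_injective S₂.iCycles).1 inferInstance
    rw [hi, hxy]

end ShortComplex

/-! ### The isomorphism in degree 2 -/

section Homology

variable {V : Type u} (G : SimpleGraph V) (n : ℕ)

theorem cubicalComplex_d :
    (cubicalComplex G).d (n + 1) n = ModuleCat.ofHom (normalizedBoundary G n) :=
  ChainComplex.of_d (fun n => ModuleCat.of ℤ (NormalizedChains G n))
    (fun n => ModuleCat.ofHom (normalizedBoundary G n)) n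

theorem cellularComplex_d :
    (cellularComplex G).d (n + 1) n = ModuleCat.ofHom (cellularBoundary G n) :=
  ChainComplex.of_d (fun n => ModuleCat.of ℤ (CellularChains G n))
    (fun n => ModuleCat.ofHom (cellularBoundary G n)) n

variable {G n} in
theorem injectivePart_comm
    (h : ∀ σ : SingularCube G (n + 1), ¬ Function.Injective σ.toFun →
      injectivePartAux G n (singularBoundary G n (Finsupp.single σ 1)) = 0) :
    injectivePart G (n + 1) ≫ (cellularComplex G).d (n + 1) n =
      (cubicalComplex G).d (n + 1) n ≫ injectivePart G n := by
  rw [cubicalComplex_d, cellularComplex_d]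
  refine ModuleCat.hom_ext (Submodule.linearMap_qext _ (LinearMap.ext fun c => ?_))
  exact (injectivePartAux_boundary h c).symm

variable {G}

/-- The injective part as a map between the parts of the two complexes around degree `2`. -/
def injectivePartMap (h₁ : TriangleFree G) (h₂ : IsQuasimonophobic G 2) :
    (cubicalComplex G).sc' 3 2 1 ⟶ (cellularComplex G).sc' 3 2 1 where
  τ₁ := injectivePart G 3
  τ₂ := injectivePart G 2
  τ₃ := injectivePart G 1
  comm₁₂ := injectivePart_comm fun _ => injectivePartAux_boundary_three h₁ h₂
  comm₂₃ := injectivePart_comm fun _ => injectivePartAux_boundary_two h₁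

theorem isIso_homologyMap_injectivePartMap (h₁ : TriangleFree G) (h₂ : IsQuasimonophobic G 2) :
    IsIso (ShortComplex.homologyMap (injectivePartMap h₁ h₂)) := by
  have h32 := injectivePartAux_boundary (G := G) (n := 2)
    fun _ => injectivePartAux_boundary_three h₁ h₂
  have h21 := injectivePartAux_boundary (G := G) (n := 1) fun _ => injectivePartAux_boundary_two h₁
  have key : (∀ (x : NormalizedChains G 2) (w : CellularChains G 3),
      normalizedBoundary G 1 x = 0 → cellularBoundary G 2 w = injectivePart G 2 x →
        ∃ v, normalizedBoundary G 2 v = x) ∧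
      (∀ y : CellularChains G 2, cellularBoundary G 1 y = 0 →
        ∃ x : NormalizedChains G 2, normalizedBoundary G 1 x = 0 ∧ injectivePart G 2 x = y) := by
    constructor
    · intro x w hx hw
      obtain ⟨c, rfl⟩ := Submodule.mkQ_surjective _ x
      obtain ⟨d, rfl⟩ := injectivePartAux_surjective w
      have hx' : singularBoundary G 1 c ∈ degenerateChains G 1 :=
        (Submodule.Quotient.mk_eq_zero _).1 hx
      change _ = injectivePartAux G 2 c at hw
      rw [← h32] at hw
      have hdd := LinearMap.congr_fun (boundary_boundary (SingularCube.face (G := G) (n := 2))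
        SingularCube.face SingularCube.face_face) d
      rw [LinearMap.comp_apply, LinearMap.zero_apply] at hdd
      -- Subtracting the boundary of a lift of `w` leaves a cycle without injective part.
      have hmem : c - singularBoundary G 2 d ∈ boundaryChains G := by
        refine mem_boundaryChains_of_injectivePartAux_eq_zero h₁ ?_ ?_
        · rw [map_sub, hw, sub_self]
        · rwa [map_sub, hdd, sub_zero]
      obtain ⟨_, ⟨d', rfl⟩, q, hq, hs⟩ := Submodule.mem_sup.1 hmem
      refine ⟨(degenerateChains G 3).mkQ (d + d'), ?_⟩
      change (degenerateChains G 2).mkQ (singularBoundary G 2 (d + d')) = _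
      rw [← sub_eq_zero, ← map_sub]
      refine (Submodule.Quotient.mk_eq_zero _).2 ?_
      have : singularBoundary G 2 (d + d') - c = -q := by
        rw [map_add, eq_neg_iff_add_eq_zero, sub_add_eq_add_sub, add_assoc, hs]
        abel
      rw [this]
      exact Submodule.neg_mem _ hq
    · intro y hy
      obtain ⟨c, rfl⟩ := injectivePartAux_surjective y
      rw [← h21] at hy
      -- The lift `c` of a cellular cycle need not be a cycle, but its boundary is, up to degenerate
      -- chains, that of some `k` without injective part. Then `c - k` is a normalized cycle with
      -- the same image.
      obtain ⟨q, hq, _, ⟨k, hk, rfl⟩, hs⟩ := Submodule.mem_sup.1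
        (ker_injectivePartAux_one_le (LinearMap.mem_ker.2 hy))
      refine ⟨(degenerateChains G 2).mkQ (c - k), ?_, ?_⟩
      · change (degenerateChains G 1).mkQ (singularBoundary G 1 (c - k)) = _
        refine (Submodule.Quotient.mk_eq_zero _).2 ?_
        rwa [map_sub, ← hs, add_sub_cancel_right]
      · change injectivePartAux G 2 (c - k) = _
        rw [map_sub, LinearMap.mem_ker.1 hk, sub_zero]
  refine isIso_homologyMap_of_forall _ ?_ ?_
  · change ∀ x w, (cubicalComplex G).d 2 1 x = 0 →
      (cellularComplex G).d 3 2 w = injectivePart G 2 x → ∃ v, (cubicalComplex G).d 3 2 v = x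
    rw [cubicalComplex_d, cubicalComplex_d, cellularComplex_d]
    exact key.1
  · change ∀ y, (cellularComplex G).d 2 1 y = 0 →
      ∃ x, (cubicalComplex G).d 2 1 x = 0 ∧ injectivePart G 2 x = y
    rw [cubicalComplex_d, cellularComplex_d]
    exact key.2

end Homology

end DiscreteCubical

end
open DiscreteCubical in
theorem mainTheorem1 {V : Type u} (G : SimpleGraph V)
    (h₁ : IsQuasimonophobic G 1) (h₂ : IsQuasimonophobic G 2) :
    ∃ (e : (cubicalComplex G).homology 2 ≅ (cellularComplex G).homology 2)
      (φ : (cubicalComplex G).cycles 2 ⟶ (cellularComplex G).cycles 2),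
      φ ≫ (cellularComplex G).iCycles 2 = (cubicalComplex G).iCycles 2 ≫ injectivePart G 2 ∧
      (cubicalComplex G).homologyπ 2 ≫ e.hom = φ ≫ (cellularComplex G).homologyπ 2 := by
  let α := (cubicalComplex G).isoSc' 3 2 1 (ChainComplex.prev ℕ 2) (ChainComplex.next_nat_succ 1)
  let β := (cellularComplex G).isoSc' 3 2 1 (ChainComplex.prev ℕ 2) (ChainComplex.next_nat_succ 1)
  let ψ := α.hom ≫ injectivePartMap h₁.triangleFree h₂ ≫ β.inv
  have hψ : ψ.τ₂ = injectivePart G 2 := by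
    -- The isomorphisms `α` and `β` only replace the indices of the neighbouring degrees, so they
    -- are identities in degree 2.
    change 𝟙 _ ≫ injectivePart G 2 ≫ 𝟙 _ = _
    rw [Category.id_comp, Category.comp_id]
  have := isIso_homologyMap_injectivePartMap h₁.triangleFree h₂
  have : IsIso (ShortComplex.homologyMap ψ) := by
    rw [ShortComplex.homologyMap_comp, ShortComplex.homologyMap_comp]
    infer_instance
  exact ⟨@asIso _ _ _ _ (ShortComplex.homologyMap ψ) this, ShortComplex.cyclesMap ψ,
    hψ ▸ ShortComplex.cyclesMap_i ψ, ShortComplex.homologyπ_naturality ψ⟩
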